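/- There is a polynomial-time algorithm (on a unit-cost random access machine with addition, subtraction and comparison, with running time bounded by a polynomial in the number $n$ of vertices) for the following problem. The input is a finite simple undirected graph $G$ given by its adjacency matrix, two vertices $s,t$ of $G$, and two minimum $s$-$t$-separators $A$ and $B$ of $G$. Here an $s$-$t$-separator is a set $S\subseteq V(G)\setminus\{s,t\}$ such that $s$ and $t$ lie in different components of $G-S$, and it is minimum if no $s$-$t$-separator has fewer elements. A sequence of token slides from $A$ to $B$ is a sequence $A=S_1,S_2,\dots,S_r=B$ ($r\ge 1$) of minimum $s$-$t$-separators such that for every $i\in\{2,\dots,r\}$ there are $v\in S_{i-1}$ and $u\in V(G)\setminus S_{i-1}$ adjacent to $v$ in $G$ with $S_i=(S_{i-1}\setminus\{v\})\cup\{u\}$. If a sequence of token slides from $A$ to $B$ exists, the algorithm outputs one with $r$ minimum; otherwise it reports that none exists. -/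

import Mathlib

/-! ### Minimum separators and token sliding -/

namespace TokenSliding

/-- `S` is an `s`-`t`-separator of `G`: neither `s` nor `t` lies in `S`, and `s` and `t` belong to
different components of `G - S`. -/
def IsSeparator {V : Type*} (G : SimpleGraph V) (s t : V) (S : Finset V) : Prop :=
  ∃ (hs : s ∉ S) (ht : t ∉ S), ¬ (G.induce {v | v ∉ S}).Reachable ⟨s, hs⟩ ⟨t, ht⟩

/-- `S` is an `s`-`t`-separator of minimum size. -/
def IsMinSeparator {V : Type*} (G : SimpleGraph V) (s t : V) (S : Finset V) : Prop :=
  IsSeparator G s t S ∧ ∀ T : Finset V, IsSeparator G s t T → S.card ≤ T.card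

/-- A token slide: one token of `S` moves from `v ∈ S` to a neighbour `u ∉ S` of `v`. -/
def IsSlide {V : Type*} [DecidableEq V] (G : SimpleGraph V) (S S' : Finset V) : Prop :=
  ∃ v ∈ S, ∃ u, u ∉ S ∧ G.Adj v u ∧ S' = insert u (S.erase v)

/-- A sequence `A = S₁, S₂, …, Sᵣ = B` (with `1 ≤ r`) of minimum `s`-`t`-separators in which each
set arises from the previous one by a token slide. -/
def IsSlideSequence {V : Type*} [DecidableEq V] (G : SimpleGraph V) (s t : V) (A B : Finset V)
    (L : List (Finset V)) : Prop :=
  L.head? = some A ∧ L.getLast? = some B ∧ (∀ S ∈ L, IsMinSeparator G s t S) ∧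
    L.IsChain (IsSlide G)

/-- A sequence of token slides from `A` to `B` of minimum length. -/
def IsShortestSlideSequence {V : Type*} [DecidableEq V] (G : SimpleGraph V) (s t : V)
    (A B : Finset V) (L : List (Finset V)) : Prop :=
  IsSlideSequence G s t A B L ∧ ∀ L', IsSlideSequence G s t A B L' → L.length ≤ L'.length

end TokenSliding

/-! ### Random access machines

The machine model is the unit-cost random access machine, programmed by structured programs. The
only arithmetic operations are addition, truncated subtraction and comparison. There is
no multiplication, so a number computed within `T` steps has only polynomially many bits in `T` and
in the size of the input, and polynomial time on this machine is polynomial time on a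
Turing machine. -/

namespace RAM

/-- The memory: number-valued variables, and number-valued arrays of unbounded length. A program
mentions only finitely many variables and arrays. -/
structure Memory where
  var : ℕ → ℕ
  arr : ℕ → ℕ → ℕ

/-- Expressions. `get a e` is the entry of array `a` at the address given by `e`. -/
inductive Expr where
  | lit (c : ℕ)
  | var (x : ℕ)
  | get (a : ℕ) (e : Expr)
  | add (e₁ e₂ : Expr)
  | sub (e₁ e₂ : Expr)
  | lt (e₁ e₂ : Expr)
  | eq (e₁ e₂ : Expr)

/-- The value of an expression; comparisons have value `1` (true) or `0` (false). -/
def Expr.eval (σ : Memory) : Expr → ℕ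
  | .lit c => c
  | .var x => σ.var x
  | .get a e => σ.arr a (e.eval σ)
  | .add e₁ e₂ => e₁.eval σ + e₂.eval σ
  | .sub e₁ e₂ => e₁.eval σ - e₂.eval σ
  | .lt e₁ e₂ => if e₁.eval σ < e₂.eval σ then 1 else 0
  | .eq e₁ e₂ => if e₁.eval σ = e₂.eval σ then 1 else 0

/-- The number of steps that evaluating an expression takes: one for each node. -/
def Expr.cost : Expr → ℕ
  | .lit _ => 1
  | .var _ => 1
  | .get _ e => e.cost + 1
  | .add e₁ e₂ => e₁.cost + e₂.cost + 1
  | .sub e₁ e₂ => e₁.cost + e₂.cost + 1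
  | .lt e₁ e₂ => e₁.cost + e₂.cost + 1
  | .eq e₁ e₂ => e₁.cost + e₂.cost + 1

/-- Programs. `assign x e` is `x := e`; `store a i e` is `a[i] := e`; `ite e P Q` runs `P` if `e` is
non-zero and `Q` otherwise; `loop e P` runs `P` as long as `e` is non-zero. -/
inductive Program where
  | skip
  | assign (x : ℕ) (e : Expr)
  | store (a : ℕ) (i e : Expr)
  | seq (P Q : Program)
  | ite (e : Expr) (P Q : Program)
  | loop (e : Expr) (P : Program)

def Memory.setVar (σ : Memory) (x v : ℕ) : Memory :=
  { σ with var := Function.update σ.var x v }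

def Memory.setArr (σ : Memory) (a i v : ℕ) : Memory :=
  { σ with arr := Function.update σ.arr a (Function.update (σ.arr a) i v) }

/-- `Exec P σ T τ`: started in memory `σ`, the program `P` halts after exactly `T` steps
with memory `τ`. (For given `P` and `σ` there is at most one such pair `T`, `τ`.) -/
inductive Exec : Program → Memory → ℕ → Memory → Prop
  | skip (σ : Memory) : Exec .skip σ 1 σ
  | assign (σ : Memory) (x : ℕ) (e : Expr) :
      Exec (.assign x e) σ (e.cost + 1) (σ.setVar x (e.eval σ))
  | store (σ : Memory) (a : ℕ) (i e : Expr) :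
      Exec (.store a i e) σ (i.cost + e.cost + 1) (σ.setArr a (i.eval σ) (e.eval σ))
  | seq {P Q : Program} {σ τ υ : Memory} {T U : ℕ} (hP : Exec P σ T τ) (hQ : Exec Q τ U υ) :
      Exec (.seq P Q) σ (T + U) υ
  | ite_true {e : Expr} {P Q : Program} {σ τ : Memory} {T : ℕ} (he : e.eval σ ≠ 0)
      (hP : Exec P σ T τ) : Exec (.ite e P Q) σ (e.cost + 1 + T) τ
  | ite_false {e : Expr} {P Q : Program} {σ τ : Memory} {T : ℕ} (he : e.eval σ = 0)
      (hQ : Exec Q σ T τ) : Exec (.ite e P Q) σ (e.cost + 1 + T) τ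
  | loop_true {e : Expr} {P : Program} {σ τ υ : Memory} {T U : ℕ} (he : e.eval σ ≠ 0)
      (hP : Exec P σ T τ) (hL : Exec (.loop e P) τ U υ) :
      Exec (.loop e P) σ (e.cost + 1 + T + U) υ
  | loop_false {e : Expr} {P : Program} {σ : Memory} (he : e.eval σ = 0) :
      Exec (.loop e P) σ (e.cost + 1) σ

end RAM

/-! ### Input and output of a program for token sliding -/

namespace TokenSliding

open Classical in
/-- The memory that holds the instance `(G, s, t, A, B)`, where `G` is a graph on the vertices
`0, …, n - 1`. Variables `0`, `1`, `2` hold `n`, `s`, `t`; array `0` holds the adjacency matrix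
of `G`, row by row; arrays `1` and `2` hold the indicator vectors of `A` and `B`; all the rest of
the memory is `0`. -/
noncomputable def inputMemory {n : ℕ} (G : SimpleGraph (Fin n)) (s t : Fin n)
    (A B : Finset (Fin n)) : RAM.Memory where
  var x := if x = 0 then n else if x = 1 then s else if x = 2 then t else 0
  arr a m :=
    if a = 0 then (if ∃ u v : Fin n, m = u * n + v ∧ G.Adj u v then 1 else 0)
    else if a = 1 then (if ∃ v ∈ A, m = v then 1 else 0)
    else if a = 2 then (if ∃ v ∈ B, m = v then 1 else 0)
    else 0

/-- The program answers "there is a sequence" by leaving `1` in variable `3`. -/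
def OutputYes (σ : RAM.Memory) : Prop := σ.var 3 = 1

/-- The program answers "there is no sequence" by leaving `0` in variable `3`. -/
def OutputNo (σ : RAM.Memory) : Prop := σ.var 3 = 0

/-- The sequence of subsets of `{0, …, n - 1}` that the program leaves in memory: variable `4` holds
the number of its members, and array `3` holds their indicator vectors, each of length `n`, one
after the other. -/
def outputSequence (n : ℕ) (σ : RAM.Memory) : List (Finset (Fin n)) :=
  List.ofFn fun i : Fin (σ.var 4) =>
    Finset.univ.filter fun v : Fin n => σ.arr 3 (i * n + v) = 1

end TokenSliding

/-! Call the component of `s` in `G - S` the side of `S`. By submodularity of vertex boundaries, the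
intersection and the union of the sides of two minimum separators are bounded by minimum separators
again. It follows that a slide between minimum separators adds exactly one vertex to the part of the
side covered by minimum separators, or removes exactly one. So the size of the symmetric difference
of these parts for `A` and `B` is a lower bound for the number of slides from `A` to `B`.

If there is a sequence from `A ≠ B` to `B`, some slide from `A` decreases the symmetric difference:
the slide of the sequence that first covers a vertex of `A` on the `s`-side (or the `t`-side) of `B`
can be exchanged for a slide of that token in `A` itself. Slides are reversible, so the same holds
after any number of such slides, and every greedy sequence attains the lower bound. Whether a slide
decreases the symmetric difference is determined by the components of `s` for `A`, for `B` and for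
the result of the slide, which are found by marking neighbours `n` times. -/

namespace TokenSliding

/-! ### Components and boundaries -/

section Components

variable {V : Type*} {G : SimpleGraph V} {S S' : Finset V} {X Y : Set V} {s u v : V}

/-- The vertex set of the component of `s` in `G - S`; it is empty if `s ∈ S`. -/
def component (G : SimpleGraph V) (S : Finset V) (s : V) : Set V :=
  {v | ∃ (hs : s ∉ S) (hv : v ∉ S), (G.induce {v | v ∉ S}).Reachable ⟨s, hs⟩ ⟨v, hv⟩}

/-- The outer vertex boundary of `X`. That `X` is a union of components of `G - S` is usually
expressed by `boundary G X ⊆ S`. -/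
def boundary (G : SimpleGraph V) (X : Set V) : Set V :=
  {v | v ∉ X ∧ ∃ x ∈ X, G.Adj x v}

theorem self_mem_component (hs : s ∉ S) : s ∈ component G S s :=
  ⟨hs, hs, .refl _⟩

theorem notMem_of_mem_component (hv : v ∈ component G S s) : v ∉ S :=
  hv.2.1

theorem mem_component_of_adj (hv : v ∈ component G S s) (hvu : G.Adj v u) (hu : u ∉ S) :
    u ∈ component G S s := by
  obtain ⟨hs, hv, hsv⟩ := hv
  have hadj : (G.induce {v | v ∉ S}).Adj ⟨v, hv⟩ ⟨u, hu⟩ := hvu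
  exact ⟨hs, hu, hsv.trans hadj.reachable⟩

theorem boundary_component_subset : boundary G (component G S s) ⊆ S := by
  rintro v ⟨hv, x, hx, hxv⟩
  by_contra hvS
  exact hv (mem_component_of_adj hx hxv hvS)

theorem component_subset (hs : s ∉ S → s ∈ X) (hX : boundary G X ⊆ S) :
    component G S s ⊆ X := by
  rintro v ⟨hsS, hvS, hsv⟩
  rw [SimpleGraph.reachable_iff_reflTransGen] at hsv
  suffices ∀ b, Relation.ReflTransGen (G.induce {v | v ∉ S}).Adj ⟨s, hsS⟩ b → b.1 ∈ X from
    this _ hsv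
  intro b hb
  induction hb with
  | refl => exact hs hsS
  | @tail b c _ hbc ih =>
    by_contra hc
    exact c.2 (hX ⟨hc, b, ih, hbc⟩)

theorem component_subset_component (hs : s ∉ S') (h : Disjoint (component G S s) S') :
    component G S s ⊆ component G S' s := by
  suffices component G S s ⊆ component G S s ∩ component G S' s from
    this.trans Set.inter_subset_right
  refine component_subset (fun hsS => ⟨self_mem_component hsS, self_mem_component hs⟩) ?_
  rintro v ⟨hv, x, ⟨hx, hx'⟩, hxv⟩
  by_contra hvS
  have hvC := mem_component_of_adj hx hxv hvS
  exact hv ⟨hvC, mem_component_of_adj hx' hxv fun hvS' => h.notMem_of_mem_left hvC hvS'⟩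

theorem boundary_union :
    boundary G (X ∪ Y) = (boundary G X ∪ boundary G Y) \ (X ∪ Y) := by
  ext v
  simp only [boundary, Set.mem_union, Set.mem_sdiff, Set.mem_ofPred_eq]
  grind

theorem boundary_inter_subset : boundary G (X ∩ Y) ⊆ boundary G X ∪ boundary G Y := by
  rintro v ⟨hv, x, ⟨hxX, hxY⟩, hxv⟩
  by_cases hvX : v ∈ X
  · exact .inr ⟨fun hvY => hv ⟨hvX, hvY⟩, x, hxY, hxv⟩
  · exact .inl ⟨hvX, x, hxX, hxv⟩

theorem boundary_inter_inter_boundary_union_subset :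
    boundary G (X ∩ Y) ∩ boundary G (X ∪ Y) ⊆ boundary G X ∩ boundary G Y := by
  rintro v ⟨⟨-, x, ⟨hxX, hxY⟩, hxv⟩, hv, -⟩
  exact ⟨⟨fun hvX => hv (.inl hvX), x, hxX, hxv⟩, ⟨fun hvY => hv (.inr hvY), x, hxY, hxv⟩⟩

end Components

/-! ### Minimum separators -/

section Separators

variable {V : Type*} {G : SimpleGraph V} {S T : Finset V} {X Y : Set V} {s t v w : V}

theorem isSeparator_iff : IsSeparator G s t S ↔ s ∉ S ∧ t ∉ S ∧ t ∉ component G S s :=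
  ⟨fun ⟨hs, ht, h⟩ => ⟨hs, ht, fun ⟨_, _, h'⟩ => h h'⟩,
    fun ⟨hs, ht, h⟩ => ⟨hs, ht, fun h' => h ⟨hs, ht, h'⟩⟩⟩

theorem exists_isSeparator_eq_boundary (hs : s ∈ X) (ht : t ∉ X) (htT : t ∉ T)
    (h : boundary G X ⊆ T) : ∃ P : Finset V, P = boundary G X ∧ IsSeparator G s t P := by
  obtain ⟨P, hP⟩ := (T.finite_toSet.subset h).exists_finset_coe
  have hPT : P ⊆ T := Finset.coe_subset.1 (hP.le.trans h)
  exact ⟨P, hP, isSeparator_iff.2 ⟨fun hsP => (hP.le hsP).1 hs, fun htP => htT (hPT htP),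
    fun htC => ht (component_subset (fun _ => hs) hP.ge htC)⟩⟩

theorem IsSeparator.symm (h : IsSeparator G s t S) : IsSeparator G t s S :=
  let ⟨hs, ht, hst⟩ := h
  ⟨ht, hs, fun hts => hst hts.symm⟩

theorem IsSeparator.disjoint_component (h : IsSeparator G s t S) :
    Disjoint (component G S s) (component G S t) :=
  Set.disjoint_left.2 fun _ ⟨_, _, hsv⟩ ⟨_, _, htv⟩ => h.2.2 (hsv.trans htv.symm)

theorem IsMinSeparator.symm (h : IsMinSeparator G s t S) : IsMinSeparator G t s S :=
  ⟨h.1.symm, fun T hT => h.2 T hT.symm⟩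

theorem IsMinSeparator.source_notMem (h : IsMinSeparator G s t S) : s ∉ S :=
  h.1.1

theorem IsMinSeparator.card_eq (hS : IsMinSeparator G s t S) (hT : IsMinSeparator G s t T) :
    S.card = T.card :=
  (hS.2 T hT.1).antisymm (hT.2 S hS.1)

theorem IsMinSeparator.of_card_eq (hS : IsMinSeparator G s t S) (hT : IsSeparator G s t T)
    (h : T.card = S.card) : IsMinSeparator G s t T :=
  ⟨hT, fun U hU => h ▸ hS.2 U hU⟩

theorem IsMinSeparator.boundary_component (h : IsMinSeparator G s t S) :
    boundary G (component G S s) = S := by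
  obtain ⟨hs, ht, hst⟩ := isSeparator_iff.1 h.1
  obtain ⟨P, hP, hPsep⟩ := exists_isSeparator_eq_boundary (self_mem_component hs) hst ht
    boundary_component_subset
  have hPS : P ⊆ S := Finset.coe_subset.1 (hP.le.trans boundary_component_subset)
  rw [← hP, Finset.eq_of_subset_of_card_le hPS (h.2 P hPsep)]

theorem IsMinSeparator.exists_adj (hS : IsMinSeparator G s t S) (hv : v ∈ S) :
    ∃ x ∈ component G S s, G.Adj x v :=
  (hS.boundary_component.ge hv).2

theorem IsMinSeparator.mem_or_mem_boundary (hS : IsMinSeparator G s t S) (hv : v ∈ S)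
    (hX : component G S s ⊆ X) : v ∈ X ∨ v ∈ boundary G X := by
  obtain ⟨x, hx, hxv⟩ := hS.exists_adj hv
  exact or_iff_not_imp_left.2 fun hvX => ⟨hvX, x, hX hx, hxv⟩

theorem IsMinSeparator.eq_of_component_subset (hS : IsMinSeparator G s t S)
    (hT : IsMinSeparator G s t T) (hs : component G T s ⊆ component G S s)
    (ht : component G T t ⊆ component G S t) : S = T := by
  refine (Finset.eq_of_subset_of_card_le (fun v hv => ?_) (hS.card_eq hT).le).symm
  by_contra hvS
  obtain ⟨x, hx, hxv⟩ := hT.exists_adj hv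
  obtain ⟨y, hy, hyv⟩ := hT.symm.exists_adj hv
  exact hS.1.disjoint_component.notMem_of_mem_left (mem_component_of_adj (hs hx) hxv hvS)
    (mem_component_of_adj (ht hy) hyv hvS)

/-- `X` is a vertex set containing `s` but not `t` whose boundary is the minimum
`s`-`t`-separator `S`. -/
structure IsSide (G : SimpleGraph V) (s t : V) (S : Finset V) (X : Set V) : Prop where
  isMinSeparator : IsMinSeparator G s t S
  source_mem : s ∈ X
  target_notMem : t ∉ X
  boundary_eq : boundary G X = S

theorem IsMinSeparator.isSide (h : IsMinSeparator G s t S) : IsSide G s t S (component G S s) :=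
  have ⟨hs, _, hst⟩ := isSeparator_iff.1 h.1
  ⟨h, self_mem_component hs, hst, h.boundary_component⟩

-- The boundary operator is submodular, so both inequalities between the cardinalities are tight.
theorem IsSide.uncross (hX : IsSide G s t S X) (hY : IsSide G s t T Y) :
    ∃ P Q : Finset V, IsSide G s t P (X ∩ Y) ∧ IsSide G s t Q (X ∪ Y) ∧
      (P : Set V) ∪ Q = (S : Set V) ∪ T := by
  classical
  have ht : t ∉ S ∪ T := by
    simp [hX.isMinSeparator.symm.source_notMem, hY.isMinSeparator.symm.source_notMem]
  have hsI : s ∈ X ∩ Y := ⟨hX.source_mem, hY.source_mem⟩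
  have htI : t ∉ X ∩ Y := fun h => hX.target_notMem h.1
  have htU : t ∉ X ∪ Y := fun h => h.elim hX.target_notMem hY.target_notMem
  have hI : boundary G (X ∩ Y) ⊆ ↑(S ∪ T) := by
    rw [Finset.coe_union, ← hX.boundary_eq, ← hY.boundary_eq]
    exact boundary_inter_subset
  have hU : boundary G (X ∪ Y) ⊆ ↑(S ∪ T) := by
    rw [Finset.coe_union, ← hX.boundary_eq, ← hY.boundary_eq, boundary_union]
    exact Set.sdiff_subset
  obtain ⟨P, hP, hPsep⟩ := exists_isSeparator_eq_boundary hsI htI ht hI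
  obtain ⟨Q, hQ, hQsep⟩ := exists_isSeparator_eq_boundary (.inl hX.source_mem) htU ht hU
  have hUnion : P ∪ Q ⊆ S ∪ T := Finset.union_subset (Finset.coe_subset.1 (hP.le.trans hI))
    (Finset.coe_subset.1 (hQ.le.trans hU))
  have hInter : P ∩ Q ⊆ S ∩ T := by
    rw [← Finset.coe_subset, Finset.coe_inter, Finset.coe_inter, hP, hQ, ← hX.boundary_eq,
      ← hY.boundary_eq]
    exact boundary_inter_inter_boundary_union_subset
  have hcard := hX.isMinSeparator.card_eq hY.isMinSeparator
  have hSP := hX.isMinSeparator.2 P hPsep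
  have hSQ := hX.isMinSeparator.2 Q hQsep
  have hPQ := Finset.card_union_add_card_inter P Q
  have hST := Finset.card_union_add_card_inter S T
  have hUnion_le := Finset.card_le_card hUnion
  have hInter_le := Finset.card_le_card hInter
  refine ⟨P, Q, ⟨hX.isMinSeparator.of_card_eq hPsep (by omega), hsI, htI, hP.symm⟩,
    ⟨hX.isMinSeparator.of_card_eq hQsep (by omega), .inl hX.source_mem, htU, hQ.symm⟩, ?_⟩
  rw [← Finset.coe_union, ← Finset.coe_union,
    Finset.eq_of_subset_of_card_le hUnion (by omega)]

theorem IsSide.inter (hX : IsSide G s t S X) (hY : IsSide G s t T Y) :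
    ∃ P, IsSide G s t P (X ∩ Y) :=
  let ⟨P, _, hP, _⟩ := hX.uncross hY
  ⟨P, hP⟩

theorem IsSide.union (hX : IsSide G s t S X) (hY : IsSide G s t T Y) :
    ∃ Q, IsSide G s t Q (X ∪ Y) :=
  let ⟨_, Q, _, hQ, _⟩ := hX.uncross hY
  ⟨Q, hQ⟩

theorem IsSide.mem_boundary_inter (hX : IsSide G s t S X) (hY : IsSide G s t T Y)
    (hw : w ∈ S) (hwY : w ∈ Y) : w ∈ boundary G (X ∩ Y) := by
  obtain ⟨P, Q, hP, hQ, hPQ⟩ := hX.uncross hY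
  rw [hP.boundary_eq]
  refine (hPQ.ge (.inl hw)).resolve_right fun hwQ => ?_
  exact (hQ.boundary_eq.ge hwQ).1 (.inr hwY)

end Separators

/-! ### Slides between minimum separators -/

section Slides

variable {V : Type*} [DecidableEq V] {G : SimpleGraph V} {S S' U W A B : Finset V} {Z : Set V}
  {s t u v w : V}

theorem card_insert_erase (hv : v ∈ S) (hu : u ∉ S) : (insert u (S.erase v)).card = S.card := by
  rw [Finset.card_insert_of_notMem (fun h => hu (Finset.mem_of_mem_erase h)),
    Finset.card_erase_add_one hv]

theorem IsSlide.symm (h : IsSlide G S S') : IsSlide G S' S := by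
  obtain ⟨v, hv, u, hu, hvu, rfl⟩ := h
  refine ⟨u, by simp, v, by simp [hvu.ne], hvu.symm, ?_⟩
  rw [Finset.erase_insert (fun h => hu (Finset.mem_of_mem_erase h)), Finset.insert_erase hv]

theorem IsSide.eq_insert_erase (hZ : IsSide G s t U Z) (hS : IsMinSeparator G s t S)
    (hSZ : component G S s ⊆ Z) (hv : v ∈ S) (hdisj : ∀ x ∈ S, x ∈ Z → x = v) (hu : u ∉ S)
    (huZ : u ∈ boundary G Z) : U = insert u (S.erase v) := by
  refine (Finset.eq_of_subset_of_card_le (Finset.insert_subset (hZ.boundary_eq.le huZ) ?_) ?_).symm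
  · intro x hx
    obtain ⟨hxv, hx⟩ := Finset.mem_erase.1 hx
    exact hZ.boundary_eq.le
      ((hS.mem_or_mem_boundary hx hSZ).resolve_left fun hxZ => hxv (hdisj x hx hxZ))
  · rw [card_insert_erase hv hu, hZ.isMinSeparator.card_eq hS]

/-- `S'` is obtained from `S` by a slide from `v` to `u` that enlarges the side of `s`; both are
minimum `s`-`t`-separators. -/
structure ForwardSlide (G : SimpleGraph V) (s t v u : V) (S S' : Finset V) : Prop where
  left : IsMinSeparator G s t S
  right : IsMinSeparator G s t S'
  mem : v ∈ S
  notMem : u ∉ S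
  adj : G.Adj v u
  eq : S' = insert u (S.erase v)
  notMem_component : u ∉ component G S s

theorem ForwardSlide.of_mem_component (hS : IsMinSeparator G s t S)
    (hS' : IsMinSeparator G s t (insert u (S.erase v))) (hv : v ∈ S) (hu : u ∉ S)
    (hvu : G.Adj v u) (huC : u ∈ component G S s) :
    ForwardSlide G s t u v (insert u (S.erase v)) S := by
  refine ⟨hS', hS, by simp, by simp [hvu.ne], hvu.symm, ?_, fun hvC => ?_⟩
  · rw [Finset.erase_insert (fun h => hu (Finset.mem_of_mem_erase h)), Finset.insert_erase hv]
  · obtain ⟨Q, hQ⟩ := hS.isSide.union hS'.isSide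
    -- The union of the two components would have too small a boundary.
    have hQsub : Q ⊆ S.erase v := fun x hx => by
      have hx := hQ.boundary_eq.ge hx
      rw [boundary_union, hS.boundary_component, hS'.boundary_component] at hx
      simp only [Set.mem_sdiff, Set.mem_union, Finset.mem_coe, Finset.mem_insert,
        Finset.mem_erase] at hx ⊢
      grind
    have hlt := (Finset.card_le_card hQsub).trans_lt (Finset.card_erase_lt_of_mem hv)
    exact hlt.ne (hQ.isMinSeparator.card_eq hS)

theorem IsSlide.exists_forwardSlide (h : IsSlide G S S') (hS : IsMinSeparator G s t S)
    (hS' : IsMinSeparator G s t S') :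
    (∃ v u, ForwardSlide G s t v u S S') ∨ ∃ v u, ForwardSlide G s t v u S' S := by
  obtain ⟨v, hv, u, hu, hvu, rfl⟩ := h
  by_cases huC : u ∈ component G S s
  · exact .inr ⟨u, v, .of_mem_component hS hS' hv hu hvu huC⟩
  · exact .inl ⟨v, u, hS, hS', hv, hu, hvu, rfl, huC⟩

namespace ForwardSlide

theorem component_subset (h : ForwardSlide G s t v u S S') :
    component G S s ⊆ component G S' s := by
  refine component_subset_component h.right.source_notMem (Set.disjoint_left.2 fun x hx hx' => ?_)
  rw [h.eq, Finset.mem_coe, Finset.mem_insert] at hx'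
  obtain rfl | hx' := hx'
  · exact h.notMem_component hx
  · exact notMem_of_mem_component hx (Finset.mem_of_mem_erase hx')

theorem source_mem_component (h : ForwardSlide G s t v u S S') : v ∈ component G S' s := by
  obtain ⟨x, hx, hxv⟩ := h.left.exists_adj h.mem
  exact mem_component_of_adj (h.component_subset hx) hxv (by simp [h.eq, h.adj.ne])

theorem target_notMem_component (h : ForwardSlide G s t v u S S') : u ∉ component G S' s :=
  fun hu => notMem_of_mem_component hu (by simp [h.eq])

theorem eq_of_mem_of_mem_component (h : ForwardSlide G s t v u S S') {x : V} (hx : x ∈ S)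
    (hxC : x ∈ component G S' s) : x = v := by
  by_contra hxv
  exact notMem_of_mem_component hxC (by simp [h.eq, hx, hxv])

theorem eq_of_mem_component (h : ForwardSlide G s t v u S S') (hW : IsMinSeparator G s t W)
    (hwW : w ∈ W) (hw' : w ∈ component G S' s) (hw : w ∉ component G S s) : w = v := by
  by_contra hwv
  have hwS : w ∉ S := fun hwS => hwv (h.eq_of_mem_of_mem_component hwS hw')
  let Z := component G S s ∪ component G W s ∩ component G S' s
  have hSZ : component G S s ⊆ Z := Set.subset_union_left
  have hZS' : Z ⊆ component G S' s := Set.union_subset h.component_subset Set.inter_subset_right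
  obtain ⟨P, hP⟩ := hW.isSide.inter h.right.isSide
  obtain ⟨U, hU : IsSide G s t U Z⟩ := h.left.isSide.union hP
  have hwZ : w ∈ boundary G Z := by
    obtain ⟨hwn, x, hx, hxw⟩ := hW.isSide.mem_boundary_inter h.right.isSide hwW hw'
    exact ⟨fun hwZ => hwZ.elim hw hwn, x, .inr hx, hxw⟩
  have hUeq : U = insert w (S.erase v) := hU.eq_insert_erase h.left hSZ h.mem
    (fun x hx hxZ => h.eq_of_mem_of_mem_component hx (hZS' hxZ)) hwS hwZ
  have hvU : v ∉ U := by simp [hUeq, Ne.symm hwv]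
  have hvZ : v ∈ Z := (h.left.mem_or_mem_boundary h.mem hSZ).resolve_right fun hvZ =>
    hvU (hU.boundary_eq.le hvZ)
  have huU : u ∈ U :=
    hU.boundary_eq.le ⟨fun huZ => h.target_notMem_component (hZS' huZ), v, hvZ, h.adj⟩
  rw [hUeq, Finset.mem_insert] at huU
  obtain rfl | huS := huU
  · exact h.target_notMem_component hw'
  · exact h.notMem (Finset.mem_of_mem_erase huS)

theorem notMem_of_source_mem (h : ForwardSlide G s t v u S S') (hA : IsMinSeparator G s t A)
    (hv : v ∈ A) : u ∉ A ∧ u ∉ component G A s := by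
  by_contra hu
  obtain ⟨Q, hQ⟩ := h.left.isSide.union hA.isSide
  obtain ⟨Q', hQ'⟩ := h.right.isSide.union hA.isSide
  have hvS : v ∉ component G S s := fun hv => notMem_of_mem_component hv h.mem
  have hvA : v ∉ component G A s := fun hvA => notMem_of_mem_component hvA hv
  have hvQ : v ∈ Q := by
    refine hQ.boundary_eq.le ?_
    rw [boundary_union, hA.boundary_component]
    exact ⟨.inr hv, fun hv => hv.elim hvS hvA⟩
  have hsub : Q' ⊆ Q.erase v := fun x hx => by
    have hx := hQ'.boundary_eq.ge hx
    have hxC : x ∉ component G S s := fun hxC => hx.1 (.inl (h.component_subset hxC))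
    have hxv : x ≠ v := fun hxv => hx.1 (.inl (hxv ▸ h.source_mem_component))
    rw [boundary_union, h.right.boundary_component, hA.boundary_component, h.eq] at hx
    refine Finset.mem_erase.2 ⟨hxv, hQ.boundary_eq.le ?_⟩
    rw [boundary_union, h.left.boundary_component, hA.boundary_component]
    simp only [Set.mem_sdiff, Set.mem_union, Finset.mem_coe, Finset.mem_insert,
      Finset.mem_erase] at hx ⊢
    grind
  have hlt := (Finset.card_le_card hsub).trans_lt (Finset.card_erase_lt_of_mem hvQ)
  exact hlt.ne (hQ'.isMinSeparator.card_eq hQ.isMinSeparator)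

theorem exchange (h : ForwardSlide G s t v u S S') (hA : IsMinSeparator G s t A)
    (hB : IsMinSeparator G s t B) (hvA : v ∈ A) (hvB : v ∈ component G B s)
    (hdisj : ∀ a ∈ A, a ∈ component G B s → a ∉ component G S s) :
    ForwardSlide G s t v u A (insert u (A.erase v)) := by
  obtain ⟨huA, huC⟩ := h.notMem_of_source_mem hA hvA
  refine ⟨hA, ?_, hvA, huA, h.adj, rfl, huC⟩
  let Z := component G A s ∪ component G S' s ∩ component G B s
  obtain ⟨P, hP⟩ := h.right.isSide.inter hB.isSide
  obtain ⟨U, hU : IsSide G s t U Z⟩ := hA.isSide.union hP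
  have huZ : u ∈ boundary G Z :=
    ⟨fun huZ => huZ.elim huC fun hu => h.target_notMem_component hu.1, v,
      .inr ⟨h.source_mem_component, hvB⟩, h.adj⟩
  have hAZ : ∀ x ∈ A, x ∈ Z → x = v := by
    rintro x hx (hxA | ⟨hxS', hxB⟩)
    · exact absurd hx (notMem_of_mem_component hxA)
    · exact h.eq_of_mem_component hA hx hxS' (hdisj x hx hxB)
  rw [← hU.eq_insert_erase hA Set.subset_union_left hvA hAZ huA huZ]
  exact hU.isMinSeparator

end ForwardSlide

end Slides

/-! ### The slide distance -/

section SlideDist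

variable {V : Type*} {G : SimpleGraph V} {S S' A B : Finset V} {P Q : Set V} {s t u v : V}

/-- The vertices of the component of `s` in `G - S` that belong to some minimum
`s`-`t`-separator. -/
def relevantSide (G : SimpleGraph V) (s t : V) (S : Finset V) : Set V :=
  {w | w ∈ component G S s ∧ ∃ W, IsMinSeparator G s t W ∧ w ∈ W}

/-- The number of slides in a shortest sequence from `S` to `B`, if there is a sequence at all. -/
noncomputable def slideDist (G : SimpleGraph V) (s t : V) (S B : Finset V) : ℕ∞ :=
  (symmDiff (relevantSide G s t S) (relevantSide G s t B)).encard

theorem slideDist_self : slideDist G s t S S = 0 := by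
  simp [slideDist]

theorem slideDist_comm : slideDist G s t A B = slideDist G s t B A := by
  rw [slideDist, slideDist, symmDiff_comm]

theorem slideDist_triangle :
    slideDist G s t A B ≤ slideDist G s t A S + slideDist G s t S B :=
  (Set.encard_le_encard (symmDiff_triangle _ _ _)).trans (Set.encard_union_le _ _)

theorem slideDist_le_card [Fintype V] : slideDist G s t A B ≤ Fintype.card V := by
  rw [← ENat.card_eq_coe_fintype_card, ← Set.encard_univ]
  exact Set.encard_le_encard (Set.subset_univ _)

theorem encard_symmDiff_insert_of_mem (hP : v ∉ P) (hQ : v ∈ Q) :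
    (symmDiff P Q).encard = (symmDiff (insert v P) Q).encard + 1 := by
  have hv : v ∉ symmDiff (insert v P) Q := by simp [Set.mem_symmDiff, hQ]
  rw [← Set.encard_insert_of_notMem hv]
  congr 1
  ext x
  simp only [Set.mem_symmDiff, Set.mem_insert_iff]
  grind

theorem encard_symmDiff_insert_of_notMem (hP : v ∉ P) (hQ : v ∉ Q) :
    (symmDiff (insert v P) Q).encard = (symmDiff P Q).encard + 1 := by
  have hv : v ∉ symmDiff P Q := by simp [Set.mem_symmDiff, hP, hQ]
  rw [← Set.encard_insert_of_notMem hv]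
  congr 1
  ext x
  simp only [Set.mem_symmDiff, Set.mem_insert_iff]
  grind

variable [DecidableEq V]

namespace ForwardSlide

theorem notMem_relevantSide (h : ForwardSlide G s t v u S S') : v ∉ relevantSide G s t S :=
  fun hv => notMem_of_mem_component hv.1 h.mem

theorem relevantSide_eq_insert (h : ForwardSlide G s t v u S S') :
    relevantSide G s t S' = insert v (relevantSide G s t S) := by
  ext w
  constructor
  · rintro ⟨hw', W, hW, hwW⟩
    by_cases hw : w ∈ component G S s
    · exact .inr ⟨hw, W, hW, hwW⟩
    · exact .inl (h.eq_of_mem_component hW hwW hw' hw)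
  · rintro (rfl | ⟨hw, W, hW, hwW⟩)
    · exact ⟨h.source_mem_component, S, h.left, h.mem⟩
    · exact ⟨h.component_subset hw, W, hW, hwW⟩

theorem slideDist_eq_one (h : ForwardSlide G s t v u S S') : slideDist G s t S S' = 1 := by
  rw [slideDist, h.relevantSide_eq_insert,
    encard_symmDiff_insert_of_mem h.notMem_relevantSide (Set.mem_insert _ _)]
  simp

end ForwardSlide

theorem IsSlide.slideDist_eq_one (h : IsSlide G S S') (hS : IsMinSeparator G s t S)
    (hS' : IsMinSeparator G s t S') : slideDist G s t S S' = 1 := by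
  obtain ⟨v, u, h⟩ | ⟨v, u, h⟩ := h.exists_forwardSlide hS hS'
  · exact h.slideDist_eq_one
  · rw [slideDist_comm, h.slideDist_eq_one]

end SlideDist

/-! ### Slide sequences -/

section Sequences

variable {V : Type*} [DecidableEq V] {G : SimpleGraph V} {S S' A B : Finset V} {s t : V}
  {L : List (Finset V)}

theorem isSlideSequence_singleton (hA : IsMinSeparator G s t A) :
    IsSlideSequence G s t A A [A] := by
  simp [IsSlideSequence, hA]

namespace IsSlideSequence

theorem concat (h : IsSlideSequence G s t A S L) (hS : IsSlide G S S')
    (hS' : IsMinSeparator G s t S') : IsSlideSequence G s t A S' (L ++ [S']) := by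
  obtain ⟨hhead, hlast, hmin, hchain⟩ := h
  refine ⟨by simp [hhead], by simp, ?_, ?_⟩
  · simpa [or_imp, forall_and, hS'] using hmin
  · exact List.isChain_append.2 ⟨hchain, .singleton _, by simpa [hlast] using hS⟩

theorem cons (h : IsSlideSequence G s t S' B L) (hS' : IsSlide G S S')
    (hS : IsMinSeparator G s t S) : IsSlideSequence G s t S B (S :: L) := by
  obtain ⟨hhead, hlast, hmin, hchain⟩ := h
  refine ⟨rfl, by simp [List.getLast?_cons, hlast], List.forall_mem_cons.2 ⟨hS, hmin⟩, ?_⟩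
  exact List.isChain_cons.2 ⟨by simpa [hhead] using hS', hchain⟩

theorem swap (h : IsSlideSequence G s t A B L) : IsSlideSequence G t s A B L :=
  ⟨h.1, h.2.1, fun S hS => (h.2.2.1 S hS).symm, h.2.2.2⟩

theorem isMinSeparator_left (h : IsSlideSequence G s t A B L) : IsMinSeparator G s t A :=
  h.2.2.1 A (List.mem_of_head? h.1)

theorem isMinSeparator_right (h : IsSlideSequence G s t A B L) : IsMinSeparator G s t B :=
  h.2.2.1 B (List.mem_of_getLast? h.2.1)

protected theorem induction {p : Finset V → Prop} (h : IsSlideSequence G s t A B L) (hA : p A)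
    (step : ∀ S S', IsMinSeparator G s t S → IsMinSeparator G s t S' → IsSlide G S S' →
      p S → p S') : p B := by
  obtain ⟨hhead, hlast, hmin, hchain⟩ := h
  refine hchain.imp_of_mem_imp (S := fun S S' => p S → p S') ?_ |>.induction p L (fun _ _ h => h) ?_
    B (List.mem_of_getLast? hlast)
  · exact fun S S' hS hS' hSS' => step S S' (hmin S hS) (hmin S' hS') hSS'
  · intro hL
    rwa [List.head_eq_iff_head?_eq_some hL |>.2 hhead]

theorem slideDist_add_one_le_length (h : IsSlideSequence G s t A B L) :
    slideDist G s t A B + 1 ≤ L.length := by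
  induction L generalizing A with
  | nil => simp [IsSlideSequence] at h
  | cons S L ih =>
    obtain ⟨hhead, hlast, hmin, hchain⟩ := h
    obtain rfl : S = A := by simpa using hhead
    cases L with
    | nil =>
      obtain rfl : S = B := by simpa using hlast
      simp [slideDist_self]
    | cons S' L =>
      rw [List.isChain_cons_cons] at hchain
      have hmin' := List.forall_mem_cons.1 hmin
      have hS' : IsMinSeparator G s t S' := hmin'.2 S' List.mem_cons_self
      have hlen := ih ⟨rfl, by simpa using hlast, hmin'.2, hchain.2⟩
      calc slideDist G s t S B + 1
          ≤ slideDist G s t S S' + slideDist G s t S' B + 1 := by grw [slideDist_triangle]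
        _ = slideDist G s t S' B + 1 + 1 := by
          rw [hchain.1.slideDist_eq_one hmin'.1 hS', add_comm 1]
        _ ≤ _ := by
          grw [hlen]
          simp

end IsSlideSequence

end Sequences

/-! ### Greedy sequences -/

section Greedy

variable {V : Type*} [DecidableEq V] {G : SimpleGraph V} {S A B : Finset V} {s t u v : V}
  {L : List (Finset V)}

theorem IsSlideSequence.exists_forwardSlide (h : IsSlideSequence G s t A B L)
    (hBA : ¬ component G B s ⊆ component G A s) :
    ∃ v u, ForwardSlide G s t v u A (insert u (A.erase v)) ∧ v ∈ component G B s := by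
  have hA := h.isMinSeparator_left
  obtain ⟨a, haB, haA⟩ : ∃ a ∈ component G B s, a ∈ A := by
    by_contra! hdisj
    exact hBA (component_subset_component hA.source_notMem (Set.disjoint_left.2 hdisj))
  by_contra! hno
  -- The slide that first covers a vertex of `A ∩ component G B s` could be made in `A` already.
  refine h.induction (p := fun S => ∀ a ∈ A, a ∈ component G B s → a ∉ component G S s)
    (fun a ha _ ha' => notMem_of_mem_component ha' ha) ?_ a haA haB haB
  intro S S' hS hS' hSS' hdisj w hwA hwB hwS'
  obtain ⟨v, u, hf⟩ | ⟨v, u, hf⟩ := hSS'.exists_forwardSlide hS hS'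
  · obtain rfl := hf.eq_of_mem_component hA hwA hwS' (hdisj w hwA hwB)
    exact hno w u (hf.exchange hA h.isMinSeparator_right hwA hwB hdisj) hwB
  · exact hdisj w hwA hwB (hf.component_subset hwS')

/-- Sliding the token of `S` on `v` to `u` yields a separator that is closer to `B`. The condition
`mem_component_iff` says that the side of `s` grows if `B` has `v` on that side, and shrinks
otherwise. -/
structure IsProgress (G : SimpleGraph V) (s t : V) (B S : Finset V) (v u : V) : Prop where
  mem : v ∈ S
  notMem : u ∉ S
  adj : G.Adj v u
  notMem_goal : v ∉ B
  mem_component_iff : v ∈ component G B s ↔ u ∉ component G S s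
  isSeparator : IsSeparator G s t (insert u (S.erase v))

theorem ForwardSlide.isProgress (h : ForwardSlide G s t v u S (insert u (S.erase v)))
    (hv : v ∈ component G B s) : IsProgress G s t B S v u :=
  ⟨h.mem, h.notMem, h.adj, notMem_of_mem_component hv, iff_of_true hv h.notMem_component,
    h.right.1⟩

theorem ForwardSlide.isProgress_swap (h : ForwardSlide G t s v u S (insert u (S.erase v)))
    (hB : IsSeparator G s t B) (hv : v ∈ component G B t) : IsProgress G s t B S v u := by
  have huC : u ∈ component G S s := by
    by_contra huC
    have hs : ForwardSlide G s t v u S (insert u (S.erase v)) :=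
      ⟨h.left.symm, h.right.symm, h.mem, h.notMem, h.adj, rfl, huC⟩
    exact h.right.1.disjoint_component.notMem_of_mem_left h.source_mem_component
      hs.source_mem_component
  exact ⟨h.mem, h.notMem, h.adj, notMem_of_mem_component hv,
    iff_of_false (hB.symm.disjoint_component.notMem_of_mem_left hv) (not_not.2 huC),
    h.right.1.symm⟩

theorem IsSlideSequence.exists_isProgress (h : IsSlideSequence G s t A B L) (hAB : A ≠ B) :
    ∃ v u, IsProgress G s t B A v u := by
  by_cases hs : component G B s ⊆ component G A s
  · have ht : ¬ component G B t ⊆ component G A t := fun ht =>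
      hAB (h.isMinSeparator_left.eq_of_component_subset h.isMinSeparator_right hs ht)
    obtain ⟨v, u, hf, hv⟩ := h.swap.exists_forwardSlide ht
    exact ⟨v, u, hf.isProgress_swap h.isMinSeparator_right.1 hv⟩
  · obtain ⟨v, u, hf, hv⟩ := h.exists_forwardSlide hs
    exact ⟨v, u, hf.isProgress hv⟩

namespace IsProgress

theorem isSlide (h : IsProgress G s t B S v u) : IsSlide G S (insert u (S.erase v)) :=
  ⟨v, h.mem, u, h.notMem, h.adj, rfl⟩

theorem isMinSeparator (h : IsProgress G s t B S v u) (hS : IsMinSeparator G s t S) :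
    IsMinSeparator G s t (insert u (S.erase v)) :=
  hS.of_card_eq h.isSeparator (card_insert_erase h.mem h.notMem)

theorem slideDist_eq (h : IsProgress G s t B S v u) (hS : IsMinSeparator G s t S) :
    slideDist G s t S B = slideDist G s t (insert u (S.erase v)) B + 1 := by
  have hS' := h.isMinSeparator hS
  rw [slideDist, slideDist]
  by_cases huC : u ∈ component G S s
  · have hf := ForwardSlide.of_mem_component hS hS' h.mem h.notMem h.adj huC
    have huB : u ∉ relevantSide G s t B := fun huB =>
      h.mem_component_iff.1 (mem_component_of_adj huB.1 h.adj.symm h.notMem_goal) huC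
    rw [hf.relevantSide_eq_insert, encard_symmDiff_insert_of_notMem hf.notMem_relevantSide huB]
  · have hf : ForwardSlide G s t v u S (insert u (S.erase v)) :=
      ⟨hS, hS', h.mem, h.notMem, h.adj, rfl, huC⟩
    rw [hf.relevantSide_eq_insert]
    exact encard_symmDiff_insert_of_mem hf.notMem_relevantSide
      ⟨h.mem_component_iff.2 huC, S, hS, h.mem⟩

end IsProgress

/-- `L` arises from `[A]` by appending the results of arbitrarily chosen progressing slides, and `S`
is its last member. -/
inductive IsGreedySequence (G : SimpleGraph V) (s t : V) (A B : Finset V) :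
    List (Finset V) → Finset V → Prop
  | singleton : IsGreedySequence G s t A B [A] A
  | concat {L : List (Finset V)} {S : Finset V} {v u : V} :
      IsGreedySequence G s t A B L S → IsProgress G s t B S v u →
        IsGreedySequence G s t A B (L ++ [insert u (S.erase v)]) (insert u (S.erase v))

namespace IsGreedySequence

theorem isSlideSequence (h : IsGreedySequence G s t A B L S) (hA : IsMinSeparator G s t A) :
    IsSlideSequence G s t A S L := by
  induction h with
  | singleton => exact isSlideSequence_singleton hA
  | concat _ hp ih => exact ih.concat hp.isSlide (hp.isMinSeparator ih.isMinSeparator_right)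

theorem length_add_slideDist (h : IsGreedySequence G s t A B L S) (hA : IsMinSeparator G s t A) :
    L.length + slideDist G s t S B = slideDist G s t A B + 1 := by
  induction h with
  | singleton => rw [List.length_singleton, Nat.cast_one, add_comm]
  | concat hL hp ih =>
    have hS := (hL.isSlideSequence hA).isMinSeparator_right
    rw [← ih, hp.slideDist_eq hS, List.length_append, List.length_singleton]
    push_cast
    ring

theorem isShortestSlideSequence (h : IsGreedySequence G s t A B L B)
    (hA : IsMinSeparator G s t A) : IsShortestSlideSequence G s t A B L := by
  refine ⟨h.isSlideSequence hA, fun L' hL' => ?_⟩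
  have hlen := h.length_add_slideDist hA
  rw [slideDist_self, add_zero] at hlen
  exact_mod_cast hlen.trans_le hL'.slideDist_add_one_le_length

theorem exists_isSlideSequence (h : IsGreedySequence G s t A B L S)
    (hAB : ∃ L, IsSlideSequence G s t A B L) : ∃ L, IsSlideSequence G s t S B L := by
  induction h with
  | singleton => exact hAB
  | concat _ hp ih =>
    obtain ⟨L, hL⟩ := ih
    have hS := hL.isMinSeparator_left
    exact ⟨_, hL.cons hp.isSlide.symm (hp.isMinSeparator hS)⟩

theorem eq_of_forall_not_isProgress (h : IsGreedySequence G s t A B L S)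
    (hAB : ∃ L, IsSlideSequence G s t A B L) (hstuck : ∀ v u, ¬ IsProgress G s t B S v u) :
    S = B := by
  by_contra hSB
  obtain ⟨L, hL⟩ := h.exists_isSlideSequence hAB
  obtain ⟨v, u, hvu⟩ := hL.exists_isProgress hSB
  exact hstuck v u hvu

theorem length_le_card_add_one [Fintype V] (h : IsGreedySequence G s t A B L S)
    (hA : IsMinSeparator G s t A) : L.length ≤ Fintype.card V + 1 := by
  have hlen : (L.length : ℕ∞) ≤ Fintype.card V + 1 := calc
    (L.length : ℕ∞) ≤ L.length + slideDist G s t S B := le_self_add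
    _ = slideDist G s t A B + 1 := h.length_add_slideDist hA
    _ ≤ Fintype.card V + 1 := by grw [slideDist_le_card]
  exact_mod_cast hlen

end IsGreedySequence

end Greedy

end TokenSliding

namespace RAM

/-! ### Programs with counted loops -/

namespace Memory

@[simp] theorem setVar_var_self (σ : Memory) (x v : ℕ) : (σ.setVar x v).var x = v := by
  simp [setVar]

theorem setVar_var (σ : Memory) (x v y : ℕ) :
    (σ.setVar x v).var y = if y = x then v else σ.var y := by
  simp [setVar, Function.update_apply]

theorem setVar_var_of_ne (σ : Memory) {x y : ℕ} (h : y ≠ x) (v : ℕ) :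
    (σ.setVar x v).var y = σ.var y := by
  rw [setVar_var, if_neg h]

@[simp] theorem setVar_arr (σ : Memory) (x v : ℕ) : (σ.setVar x v).arr = σ.arr := rfl

@[simp] theorem setArr_var (σ : Memory) (a i v : ℕ) : (σ.setArr a i v).var = σ.var := rfl

@[simp] theorem setArr_arr_self (σ : Memory) (a i v : ℕ) :
    (σ.setArr a i v).arr a = Function.update (σ.arr a) i v := by
  simp [setArr]

theorem setArr_arr_of_ne (σ : Memory) {a b : ℕ} (h : b ≠ a) (i v : ℕ) :
    (σ.setArr a i v).arr b = σ.arr b := by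
  simp [setArr, Function.update_of_ne h]

end Memory

/-- Structured programs in which every loop is a counted one: `loop x P` runs `P` for all values
of variable `x` from `0` up to, but not including, the value of variable `0`. -/
inductive ForProgram where
  | skip
  | assign (x : ℕ) (e : Expr)
  | store (a : ℕ) (i e : Expr)
  | seq (P Q : ForProgram)
  | ite (e : Expr) (P Q : ForProgram)
  | loop (x : ℕ) (P : ForProgram)

namespace ForProgram

/-- The translation of a program with counted loops into the language of the machine. -/
def compile : ForProgram → Program
  | skip => .skip
  | assign x e => .assign x e
  | store a i e => .store a i e
  | seq P Q => .seq P.compile Q.compile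
  | ite e P Q => .ite e P.compile Q.compile
  | loop x P => .seq (.assign x (.lit 0)) (.loop (.lt (.var x) (.var 0))
      (.seq P.compile (.assign x (.add (.var x) (.lit 1)))))

/-- The denotational semantics: the memory after a run of the program. It describes the compiled
program only if the program is `WellFormed`. -/
def run : ForProgram → Memory → Memory
  | skip, σ => σ
  | assign x e, σ => σ.setVar x (e.eval σ)
  | store a i e, σ => σ.setArr a (i.eval σ) (e.eval σ)
  | seq P Q, σ => Q.run (P.run σ)
  | ite e P Q, σ => if e.eval σ ≠ 0 then P.run σ else Q.run σ
  | loop x P, σ =>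
      (fun τ => (P.run τ).setVar x ((P.run τ).var x + 1))^[σ.var 0] (σ.setVar x 0)

/-- The variables that the program may change. -/
def writtenVars : ForProgram → List ℕ
  | skip => []
  | assign x _ => [x]
  | store _ _ _ => []
  | seq P Q => P.writtenVars ++ Q.writtenVars
  | ite _ P Q => P.writtenVars ++ Q.writtenVars
  | loop x P => x :: P.writtenVars

/-- The arrays that the program may change. -/
def writtenArrs : ForProgram → List ℕ
  | skip => []
  | assign _ _ => []
  | store a _ _ => [a]
  | seq P Q => P.writtenArrs ++ Q.writtenArrs
  | ite _ P Q => P.writtenArrs ++ Q.writtenArrs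
  | loop _ P => P.writtenArrs

/-- The condition under which loops are really counted: variable `0` is never written, and the body
of a loop does not write the loop variable. -/
def WellFormed : ForProgram → Prop
  | skip => True
  | assign x _ => x ≠ 0
  | store _ _ _ => True
  | seq P Q => P.WellFormed ∧ Q.WellFormed
  | ite _ P Q => P.WellFormed ∧ Q.WellFormed
  | loop x P => x ≠ 0 ∧ x ∉ P.writtenVars ∧ P.WellFormed

theorem run_seq (P Q : ForProgram) (σ : Memory) : (seq P Q).run σ = Q.run (P.run σ) := rfl

/-- The frame rule for `P`: two memories agree on everything that `P` does not write. -/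
structure Frame (P : ForProgram) (σ τ : Memory) : Prop where
  var : ∀ x ∉ P.writtenVars, τ.var x = σ.var x
  arr : ∀ a ∉ P.writtenArrs, τ.arr a = σ.arr a

theorem Frame.trans {P : ForProgram} {σ τ υ : Memory} (h : P.Frame σ τ) (h' : P.Frame τ υ) :
    P.Frame σ υ :=
  ⟨fun x hx => (h'.var x hx).trans (h.var x hx), fun a ha => (h'.arr a ha).trans (h.arr a ha)⟩

theorem Frame.loop {P : ForProgram} {σ τ : Memory} (h : P.Frame σ τ) (x : ℕ) :
    (loop x P).Frame σ τ :=
  ⟨fun y hy => h.var y (List.not_mem_of_not_mem_cons hy), h.arr⟩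

theorem frame_loop_setVar (x : ℕ) (P : ForProgram) (σ : Memory) (v : ℕ) :
    (loop x P).Frame σ (σ.setVar x v) :=
  ⟨fun _ hy => σ.setVar_var_of_ne (List.ne_of_not_mem_cons hy) v, fun _ _ => rfl⟩

theorem frame_run (P : ForProgram) (σ : Memory) : P.Frame σ (P.run σ) := by
  induction P generalizing σ with
  | skip => exact ⟨fun _ _ => rfl, fun _ _ => rfl⟩
  | assign x e => exact ⟨fun y hy => σ.setVar_var_of_ne (by simpa [writtenVars] using hy) _,
      fun _ _ => rfl⟩
  | store a i e => exact ⟨fun _ _ => rfl,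
      fun b hb => σ.setArr_arr_of_ne (by simpa [writtenArrs] using hb) _ _⟩
  | seq P Q ihP ihQ =>
    refine Frame.trans ⟨fun x hx => (ihP σ).var x ?_, fun a ha => (ihP σ).arr a ?_⟩
      ⟨fun x hx => (ihQ _).var x ?_, fun a ha => (ihQ _).arr a ?_⟩ <;>
      simp_all [writtenVars, writtenArrs]
  | ite e P Q ihP ihQ =>
    rw [run]
    split
    · exact ⟨fun x hx => (ihP σ).var x (by simp_all [writtenVars]),
        fun a ha => (ihP σ).arr a (by simp_all [writtenArrs])⟩
    · exact ⟨fun x hx => (ihQ σ).var x (by simp_all [writtenVars]),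
        fun a ha => (ihQ σ).arr a (by simp_all [writtenArrs])⟩
  | loop x P ih =>
    exact Function.Iterate.rec ((ForProgram.loop x P).Frame σ) (frame_loop_setVar x P σ 0)
      (fun τ hτ => (hτ.trans ((ih τ).loop x)).trans (frame_loop_setVar x P _ _)) _

theorem run_var_eq {P : ForProgram} {x : ℕ} (hx : x ∉ P.writtenVars) (σ : Memory) :
    (P.run σ).var x = σ.var x :=
  (P.frame_run σ).var x hx

theorem run_arr_eq {P : ForProgram} {a : ℕ} (ha : a ∉ P.writtenArrs) (σ : Memory) :
    (P.run σ).arr a = σ.arr a :=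
  (P.frame_run σ).arr a ha

theorem WellFormed.zero_notMem {P : ForProgram} (h : P.WellFormed) : 0 ∉ P.writtenVars := by
  induction P with
  | skip | store => exact List.not_mem_nil
  | assign y e => simpa [writtenVars] using Ne.symm h
  | seq P Q ihP ihQ | ite e P Q ihP ihQ => simpa [writtenVars] using ⟨ihP h.1, ihQ h.2⟩
  | loop y P ih => simpa [writtenVars] using ⟨Ne.symm h.1, ih h.2.2⟩

/-! ### Running time -/

theorem exists_exec_counted_loop {P : ForProgram} {x : ℕ} (h : (loop x P).WellFormed) {b : ℕ → ℕ}
    (hb : ∀ σ, ∃ T ≤ b (σ.var 0), Exec P.compile σ T (P.run σ)) (k : ℕ) (σ : Memory)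
    (hσ : σ.var x + k = σ.var 0) :
    ∃ T ≤ k * (b (σ.var 0) + 8) + 4,
      Exec (.loop (.lt (.var x) (.var 0)) (.seq P.compile (.assign x (.add (.var x) (.lit 1)))))
        σ T ((fun τ => (P.run τ).setVar x ((P.run τ).var x + 1))^[k] σ) := by
  obtain ⟨hx0, hx, hP⟩ := h
  induction k generalizing σ with
  | zero =>
    have hdone : ¬ σ.var x < σ.var 0 := by omega
    exact ⟨_, by simp [Expr.cost], .loop_false (by simp [Expr.eval, hdone])⟩
  | succ k ih =>
    have hsize : ((P.run σ).setVar x ((P.run σ).var x + 1)).var 0 = σ.var 0 := by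
      rw [Memory.setVar_var_of_ne _ hx0.symm, run_var_eq hP.zero_notMem]
    have hcount : ((P.run σ).setVar x ((P.run σ).var x + 1)).var x = σ.var x + 1 := by
      rw [Memory.setVar_var_self, run_var_eq hx]
    obtain ⟨T, hT, hbody⟩ := hb σ
    obtain ⟨U, hU, hrest⟩ := ih ((P.run σ).setVar x ((P.run σ).var x + 1)) (by omega)
    have hmore : σ.var x < σ.var 0 := by omega
    refine ⟨_, ?_, .loop_true (by simp [Expr.eval, hmore]) (.seq hbody (.assign _ _ _)) hrest⟩
    rw [hsize] at hU
    simp only [Expr.cost, Nat.succ_mul]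
    omega

theorem WellFormed.exists_exec {P : ForProgram} (h : P.WellFormed) : ∃ p : Polynomial ℕ,
    ∀ σ : Memory, ∃ T ≤ p.eval (σ.var 0), Exec P.compile σ T (P.run σ) := by
  induction P with
  | skip => exact ⟨1, fun σ => ⟨1, by simp, .skip σ⟩⟩
  | assign x e => exact ⟨.C (e.cost + 1), fun σ => ⟨_, by simp, .assign σ x e⟩⟩
  | store a i e => exact ⟨.C (i.cost + e.cost + 1), fun σ => ⟨_, by simp, .store σ a i e⟩⟩
  | seq P Q ihP ihQ =>
    obtain ⟨p, hp⟩ := ihP h.1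
    obtain ⟨q, hq⟩ := ihQ h.2
    refine ⟨p + q, fun σ => ?_⟩
    obtain ⟨T, hT, hP⟩ := hp σ
    obtain ⟨U, hU, hQ⟩ := hq (P.run σ)
    rw [run_var_eq h.1.zero_notMem] at hU
    exact ⟨T + U, by simpa using Nat.add_le_add hT hU, .seq hP hQ⟩
  | ite e P Q ihP ihQ =>
    obtain ⟨p, hp⟩ := ihP h.1
    obtain ⟨q, hq⟩ := ihQ h.2
    refine ⟨.C (e.cost + 1) + p + q, fun σ => ?_⟩
    simp only [Polynomial.eval_add, Polynomial.eval_C]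
    by_cases he : e.eval σ = 0
    · obtain ⟨T, hT, hQ⟩ := hq σ
      exact ⟨e.cost + 1 + T, by omega, by simpa [run, compile, he] using Exec.ite_false he hQ⟩
    · obtain ⟨T, hT, hP⟩ := hp σ
      exact ⟨e.cost + 1 + T, by omega, by simpa [run, compile, he] using Exec.ite_true he hP⟩
  | loop x P ih =>
    obtain ⟨p, hp⟩ := ih h.2.2
    refine ⟨.X * (p + .C 8) + .C 6, fun σ => ?_⟩
    have hsize : (σ.setVar x 0).var 0 = σ.var 0 := σ.setVar_var_of_ne h.1.symm 0
    obtain ⟨T, hT, hloop⟩ := exists_exec_counted_loop (b := p.eval) h hp (σ.var 0) (σ.setVar x 0)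
      (by simp [hsize])
    refine ⟨_, ?_, .seq (.assign _ _ _) hloop⟩
    rw [hsize] at hT
    simp only [Expr.cost, Polynomial.eval_add, Polynomial.eval_mul, Polynomial.eval_X,
      Polynomial.eval_C]
    omega

/-! ### Reasoning about loops -/

theorem loop_invariant {x : ℕ} {P : ForProgram} {σ : Memory} (hx : x ∉ P.writtenVars)
    (I : ℕ → Memory → Prop) (hzero : I 0 (σ.setVar x 0))
    (hstep : ∀ i τ, i < σ.var 0 → τ.var x = i → (loop x P).Frame σ τ → I i τ →
      I (i + 1) ((P.run τ).setVar x (i + 1))) :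
    I (σ.var 0) ((loop x P).run σ) := by
  suffices H : ∀ k ≤ σ.var 0, ∀ τ,
      τ = (fun τ => (P.run τ).setVar x ((P.run τ).var x + 1))^[k] (σ.setVar x 0) →
      τ.var x = k ∧ (loop x P).Frame σ τ ∧ I k τ from (H _ le_rfl _ rfl).2.2
  intro k
  induction k with
  | zero =>
    rintro - τ rfl
    exact ⟨σ.setVar_var_self x 0, frame_loop_setVar x P σ 0, hzero⟩
  | succ k ih =>
    rintro hk τ rfl
    obtain ⟨hcount, hframe, hI⟩ := ih (by omega) _ rfl
    rw [Function.iterate_succ_apply', run_var_eq hx, hcount]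
    exact ⟨Memory.setVar_var_self _ _ _,
      (hframe.trans ((frame_run P _).loop x)).trans (frame_loop_setVar x P _ _),
      hstep k _ (by omega) hcount hframe hI⟩

/-- A pair of nested loops processes the pairs of numbers below the value of variable `0`, so its
invariant can be indexed by the set of the pairs processed so far. -/
theorem loop_loop_invariant {x y : ℕ} {P : ForProgram} {σ : Memory} (hxy : x ≠ y)
    (hx : x ∉ P.writtenVars) (hy : y ∉ P.writtenVars) (h0 : 0 ∉ (loop x (loop y P)).writtenVars)
    (J : Set (ℕ × ℕ) → Memory → Prop) (hzero : J ∅ σ)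
    (hsetVar : ∀ D τ z v, z = x ∨ z = y → J D τ → J D (τ.setVar z v))
    (hstep : ∀ D i j τ, i < σ.var 0 → j < σ.var 0 → τ.var x = i → τ.var y = j →
      (loop x (loop y P)).Frame σ τ → J D τ → J (insert (i, j) D) (P.run τ)) :
    J {p | p.1 < σ.var 0 ∧ p.2 < σ.var 0} ((loop x (loop y P)).run σ) := by
  have houter := loop_invariant (x := x) (P := loop y P) (σ := σ) (by simp [writtenVars, hx, hxy])
    (fun i τ => J {p | p.1 < i ∧ p.2 < σ.var 0} τ)
    (by simpa using hsetVar _ _ _ 0 (.inl rfl) hzero)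
  refine houter fun i τ hi hτ hframe hJ => hsetVar _ _ _ _ (.inl rfl) ?_
  have hsize : τ.var 0 = σ.var 0 := hframe.var 0 h0
  have hinner := loop_invariant (x := y) (P := P) (σ := τ) hy
    (fun j υ => J ({p | p.1 < i ∧ p.2 < σ.var 0} ∪ {p | p.1 = i ∧ p.2 < j}) υ)
    (by simpa using hsetVar _ _ _ 0 (.inr rfl) hJ)
  convert hinner fun j υ hj hυ hframe' hJ' => hsetVar _ _ _ _ (.inr rfl) ?_ using 1
  · ext ⟨a, b⟩
    simp only [Set.mem_ofPred_eq, Set.mem_union, hsize]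
    omega
  · convert hstep _ i j υ hi (hsize ▸ hj) ?_ hυ (hframe.trans (hframe'.loop x)) hJ' using 1
    · ext ⟨a, b⟩
      simp only [Set.mem_ofPred_eq, Set.mem_union, Set.mem_insert_iff, Prod.mk.injEq]
      omega
    · rw [hframe'.var x (by simp [writtenVars, hx, hxy]), hτ]

/-! ### Guarded programs -/

/-- The program that runs `P` if all the expressions are non-zero. -/
def whenAll : List Expr → ForProgram → ForProgram
  | [], P => P
  | e :: es, P => ite e (whenAll es P) skip

open Classical in
theorem run_whenAll (es : List Expr) (P : ForProgram) (σ : Memory) :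
    (whenAll es P).run σ = if ∀ e ∈ es, e.eval σ ≠ 0 then P.run σ else σ := by
  induction es with
  | nil => simp [whenAll]
  | cons e es ih => by_cases he : e.eval σ = 0 <;> simp [whenAll, run, he, ih]

@[simp] theorem writtenVars_whenAll (es : List Expr) (P : ForProgram) :
    (whenAll es P).writtenVars = P.writtenVars := by
  induction es with
  | nil => rfl
  | cons e es ih => simp [whenAll, writtenVars, ih]

@[simp] theorem writtenArrs_whenAll (es : List Expr) (P : ForProgram) :
    (whenAll es P).writtenArrs = P.writtenArrs := by
  induction es with
  | nil => rfl
  | cons e es ih => simp [whenAll, writtenArrs, ih]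

@[simp] theorem wellFormed_whenAll (es : List Expr) (P : ForProgram) :
    (whenAll es P).WellFormed ↔ P.WellFormed := by
  induction es with
  | nil => rfl
  | cons e es ih => simp [whenAll, WellFormed, ih]

end ForProgram

end RAM

namespace TokenSliding

open RAM RAM.ForProgram

/-! ### The program -/

/- Variables and arrays of the program. Input and output fix the variables `0` to `4` and the
arrays `0` to `3`; array `1` is overwritten with the current separator. -/

@[simp] abbrev sizeVar : ℕ := 0
@[simp] abbrev sourceVar : ℕ := 1
@[simp] abbrev sinkVar : ℕ := 2
@[simp] abbrev answerVar : ℕ := 3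
@[simp] abbrev countVar : ℕ := 4
@[simp] abbrev indexVar : ℕ := 5
@[simp] abbrev offsetVar : ℕ := 6
@[simp] abbrev roundVar : ℕ := 7
@[simp] abbrev rowVar : ℕ := 8
@[simp] abbrev colVar : ℕ := 9
@[simp] abbrev stepVar : ℕ := 10
@[simp] abbrev fromVar : ℕ := 11
@[simp] abbrev toVar : ℕ := 12
@[simp] abbrev foundVar : ℕ := 13
@[simp] abbrev foundFromVar : ℕ := 14
@[simp] abbrev foundToVar : ℕ := 15
@[simp] abbrev outputEndVar : ℕ := 16

@[simp] abbrev adjArr : ℕ := 0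
@[simp] abbrev currentArr : ℕ := 1
@[simp] abbrev goalArr : ℕ := 2
@[simp] abbrev outputArr : ℕ := 3
@[simp] abbrev rowArr : ℕ := 4
@[simp] abbrev goalSideArr : ℕ := 5
@[simp] abbrev currentSideArr : ℕ := 6
@[simp] abbrev trialArr : ℕ := 7
@[simp] abbrev trialSideArr : ℕ := 8

/-- The entry of the adjacency matrix in the row and the column given by two variables. Without
multiplication, the address of a row has to be looked up in an array. -/
def adjExpr (x y : ℕ) : Expr := .get adjArr (.add (.get rowArr (.var x)) (.var y))

/-- The negation of the truth value of an expression. -/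
def negExpr (e : Expr) : Expr := .eq e (.lit 0)

/-- The program that stores the addresses of the rows of the adjacency matrix. -/
def buildRows : ForProgram :=
  .seq (.assign offsetVar (.lit 0)) (.loop indexVar
    (.seq (.store rowArr (.var indexVar) (.var offsetVar))
      (.assign offsetVar (.add (.var offsetVar) (.var sizeVar)))))

/-- The program that stores the values of `e` for all values of the index variable in array `a`,
at the addresses given by `i`. -/
def fill (a : ℕ) (i e : Expr) : ForProgram := .loop indexVar (.store a i e)

/-- One step of the search for a component: if the vertex in the row variable is marked in array
`m`, mark its neighbour in the column variable, unless that vertex is in array `a`. -/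
def markNeighbor (a m : ℕ) : ForProgram :=
  whenAll [.get m (.var rowVar), adjExpr rowVar colVar, negExpr (.get a (.var colVar))]
    (.store m (.var colVar) (.lit 1))

/-- One round of the search for a component: `markNeighbor` for all pairs of vertices. -/
def markNeighbors (a m : ℕ) : ForProgram := .loop rowVar (.loop colVar (markNeighbor a m))

/-- The program that marks in array `m` the component of the source after deletion of the set in
array `a`. -/
def markComponent (a m : ℕ) : ForProgram :=
  .seq (fill m (.var indexVar) (.lit 0))
    (.seq (whenAll [negExpr (.get a (.var sourceVar))] (.store m (.var sourceVar) (.lit 1)))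
      (.loop roundVar (markNeighbors a m)))

/-- The program that moves a token in array `a`. -/
def moveToken (a x y : ℕ) : ForProgram :=
  .seq (.store a (.var x) (.lit 0)) (.store a (.var y) (.lit 1))

/-- The program that computes the result of a slide, and the component of the source after
deletion of that set. -/
def prepareTrial : ForProgram :=
  .seq (fill trialArr (.var indexVar) (.get currentArr (.var indexVar)))
    (.seq (moveToken trialArr fromVar toVar) (markComponent trialArr trialSideArr))

/-- The conditions for a slide to be `IsProgress`. -/
def progressConditions : List Expr :=
  [.get currentArr (.var fromVar), negExpr (.get currentArr (.var toVar)), adjExpr fromVar toVar,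
    negExpr (.get goalArr (.var fromVar)),
    .eq (negExpr (.get goalSideArr (.var fromVar)))
      (.lt (.lit 0) (.get currentSideArr (.var toVar))),
    negExpr (.get trialArr (.var sourceVar)), negExpr (.get trialArr (.var sinkVar)),
    negExpr (.get trialSideArr (.var sinkVar))]

/-- The program that tests whether a slide is `IsProgress` and, if so, records it. -/
def trySlide : ForProgram :=
  .seq prepareTrial (whenAll progressConditions (.seq (.assign foundVar (.lit 1))
    (.seq (.assign foundFromVar (.var fromVar)) (.assign foundToVar (.var toVar)))))

/-- The program that looks for a slide that `IsProgress`. -/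
def searchSlide : ForProgram :=
  .seq (.assign foundVar (.lit 0)) (.loop fromVar (.loop toVar trySlide))

/-- The program that appends the current set to the output. -/
def appendOutput : ForProgram :=
  .seq (fill outputArr (.add (.var outputEndVar) (.var indexVar))
      (.lt (.lit 0) (.get currentArr (.var indexVar))))
    (.seq (.assign countVar (.add (.var countVar) (.lit 1)))
      (.assign outputEndVar (.add (.var outputEndVar) (.var sizeVar))))

/-- The program that performs one slide of a greedy sequence, if there is one. -/
def slideOnce : ForProgram :=
  .seq (markComponent currentArr currentSideArr) (.seq searchSlide (whenAll [.var foundVar]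
    (.seq (moveToken currentArr foundFromVar foundToVar) appendOutput)))

/-- The program that tests whether the current set is contained in the goal. -/
def decideDone : ForProgram :=
  .seq (.assign answerVar (.lit 1)) (.loop indexVar
    (whenAll [.get currentArr (.var indexVar), negExpr (.get goalArr (.var indexVar))]
      (.assign answerVar (.lit 0))))

/-- The greedy algorithm. Since a greedy sequence has at most `n + 1` members, `n` steps are
enough. -/
def slidingProgram : ForProgram :=
  .seq buildRows (.seq (markComponent goalArr goalSideArr) (.seq appendOutput
    (.seq (.loop stepVar slideOnce) decideDone)))

theorem slidingProgram_wellFormed : slidingProgram.WellFormed := by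
  simp [slidingProgram, buildRows, fill, markComponent, markNeighbors, markNeighbor, moveToken,
    prepareTrial, trySlide, searchSlide, appendOutput, slideOnce, decideDone, WellFormed,
    writtenVars]

/-! ### Memory contents -/

section Contents

variable {n : ℕ} {G : SimpleGraph (Fin n)} {s t u v : Fin n} {S B : Finset (Fin n)}
  {L : List (Finset (Fin n))} {σ τ : Memory} {f g : ℕ → ℕ}

/-- The subset of `{0, …, n - 1}` whose indicator vector is `f`; any non-zero entry counts. -/
def indicatedSet (n : ℕ) (f : ℕ → ℕ) : Finset (Fin n) := {v | f v ≠ 0}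

@[simp] theorem mem_indicatedSet : v ∈ indicatedSet n f ↔ f v ≠ 0 := by simp [indicatedSet]

theorem indicatedSet_congr (h : ∀ i < n, f i = g i) : indicatedSet n f = indicatedSet n g := by
  ext v
  rw [mem_indicatedSet, mem_indicatedSet, h v v.2]

theorem indicatedSet_update_zero :
    indicatedSet n (Function.update f v 0) = (indicatedSet n f).erase v := by
  ext w
  by_cases h : w = v <;> simp [h, Fin.val_inj]

theorem indicatedSet_update_one :
    indicatedSet n (Function.update f v 1) = insert v (indicatedSet n f) := by
  ext w
  by_cases h : w = v <;> simp [h, Fin.val_inj]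

theorem outputSequence_congr (hcount : τ.var countVar = σ.var countVar)
    (hout : τ.arr outputArr = σ.arr outputArr) : outputSequence n τ = outputSequence n σ := by
  simp only [countVar, outputArr] at hcount hout
  rw [outputSequence, outputSequence, hout, hcount]

theorem outputSequence_eq_concat (hcount : τ.var countVar = σ.var countVar + 1)
    (hold : ∀ k < σ.var countVar * n, τ.arr outputArr k = σ.arr outputArr k)
    (hnew : ∀ v : Fin n, τ.arr outputArr (σ.var countVar * n + v) = 1 ↔ v ∈ S) :
    outputSequence n τ = outputSequence n σ ++ [S] := by
  refine List.ext_getElem (by simpa [outputSequence] using hcount) fun i hi _ => ?_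
  rcases Nat.lt_succ_iff_lt_or_eq.1 (by simpa [outputSequence, hcount] using hi) with hi | rfl
  · rw [List.getElem_append_left (by simpa [outputSequence] using hi)]
    simp only [outputSequence, List.getElem_ofFn]
    refine Finset.filter_congr fun v _ => ?_
    rw [hold]
    calc i * n + v < (i + 1) * n := by rw [Nat.succ_mul]; exact Nat.add_lt_add_left v.2 _
      _ ≤ σ.var countVar * n := Nat.mul_le_mul_right n hi
  · rw [List.getElem_append_right (by simp [outputSequence])]
    ext v
    simp [outputSequence, ← hnew]

/-- The memory holds the graph, the two terminals and the addresses of the rows. -/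
structure StoresGraph (G : SimpleGraph (Fin n)) (s t : Fin n) (σ : Memory) : Prop where
  size : σ.var sizeVar = n
  source : σ.var sourceVar = s
  sink : σ.var sinkVar = t
  adj : ∀ u v : Fin n, σ.arr adjArr (u * n + v) ≠ 0 ↔ G.Adj u v
  rows : ∀ i < n, σ.arr rowArr i = i * n

theorem StoresGraph.frame {P : ForProgram} (h : StoresGraph G s t σ) (hP : P.Frame σ τ)
    (hvar : ∀ x ∈ [sizeVar, sourceVar, sinkVar], x ∉ P.writtenVars)
    (harr : ∀ a ∈ [adjArr, rowArr], a ∉ P.writtenArrs) : StoresGraph G s t τ where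
  size := by rw [hP.var _ (hvar _ (by simp)), h.size]
  source := by rw [hP.var _ (hvar _ (by simp)), h.source]
  sink := by rw [hP.var _ (hvar _ (by simp)), h.sink]
  adj u v := by rw [hP.arr _ (harr _ (by simp)), h.adj]
  rows i hi := by rw [hP.arr _ (harr _ (by simp)), h.rows i hi]

/-- The memory holds a state of the greedy algorithm: the instance, the side of `s` in `G - B`, the
current set `S` and the output `L`. -/
structure StoresState (G : SimpleGraph (Fin n)) (s t : Fin n) (B S : Finset (Fin n))
    (L : List (Finset (Fin n))) (σ : Memory) : Prop extends StoresGraph G s t σ where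
  current : indicatedSet n (σ.arr currentArr) = S
  goal : indicatedSet n (σ.arr goalArr) = B
  goalSide : indicatedSet n (σ.arr goalSideArr) = component G B s
  output : outputSequence n σ = L
  outputEnd : σ.var outputEndVar = σ.var countVar * n

theorem StoresState.frame {P : ForProgram} (h : StoresState G s t B S L σ) (hP : P.Frame σ τ)
    (hvar : ∀ x ∈ [sizeVar, sourceVar, sinkVar, countVar, outputEndVar], x ∉ P.writtenVars)
    (harr : ∀ a ∈ [adjArr, rowArr, currentArr, goalArr, goalSideArr, outputArr],
      a ∉ P.writtenArrs) : StoresState G s t B S L τ where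
  toStoresGraph := h.toStoresGraph.frame hP (fun x hx => hvar x (by aesop))
    (fun a ha => harr a (by aesop))
  current := by rw [hP.arr _ (harr _ (by simp)), h.current]
  goal := by rw [hP.arr _ (harr _ (by simp)), h.goal]
  goalSide := by rw [hP.arr _ (harr _ (by simp)), h.goalSide]
  output := by
    rw [outputSequence_congr (hP.var _ (hvar _ (by simp))) (hP.arr _ (harr _ (by simp))), h.output]
  outputEnd := by
    rw [hP.var _ (hvar _ (by simp)), hP.var countVar (hvar _ (by simp)), h.outputEnd]

theorem StoresState.setVar (h : StoresState G s t B S L σ) {x : ℕ}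
    (hx : x ∉ [sizeVar, sourceVar, sinkVar, countVar, outputEndVar]) (i : ℕ) :
    StoresState G s t B S L (σ.setVar x i) :=
  h.frame (frame_run (.assign x (.lit i)) σ)
    (fun y hy hyx => hx (by rwa [← List.mem_singleton.1 hyx])) fun _ _ => List.not_mem_nil

theorem eval_negExpr_ne_zero {e : Expr} : (negExpr e).eval σ ≠ 0 ↔ e.eval σ = 0 := by
  by_cases h : e.eval σ = 0 <;> simp [negExpr, Expr.eval, h]

theorem StoresGraph.eval_adjExpr_ne_zero (h : StoresGraph G s t σ) {x y : ℕ} (hx : σ.var x = u)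
    (hy : σ.var y = v) : (adjExpr x y).eval σ ≠ 0 ↔ G.Adj u v := by
  rw [← h.adj u v]
  simp only [adjExpr, Expr.eval, hx, hy, h.rows u u.2]

end Contents

section Routines

variable {n : ℕ} {G : SimpleGraph (Fin n)} {s t u v : Fin n}
  {L : List (Finset (Fin n))} {σ τ : Memory} {a m : ℕ}

/-! ### Filling arrays -/

theorem buildRows_run (hsize : σ.var sizeVar = n) {i : ℕ} (hi : i < n) :
    (buildRows.run σ).arr rowArr i = i * n := by
  rw [buildRows, run_seq]
  set σ₁ := (ForProgram.assign offsetVar (.lit 0)).run σ with hσ₁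
  have hsize₁ : σ₁.var sizeVar = n := (run_var_eq (by decide) σ).trans hsize
  have hloop := loop_invariant (x := indexVar) (σ := σ₁)
    (P := .seq (.store rowArr (.var indexVar) (.var offsetVar))
      (.assign offsetVar (.add (.var offsetVar) (.var sizeVar)))) (by decide)
    (fun i τ => τ.var offsetVar = i * n ∧ ∀ j < i, τ.arr rowArr j = j * n)
    (by simp [hσ₁, run, Expr.eval, Memory.setVar_var])
    fun i τ _ hi hframe ⟨hoffset, hrows⟩ => by
      have hsizeτ : τ.var sizeVar = n := (hframe.var _ (by decide)).trans hsize₁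
      constructor
      · simp_all [run, Expr.eval, Memory.setVar_var, Nat.succ_mul]
      · intro j hj
        rcases Nat.lt_succ_iff_lt_or_eq.1 hj with hj | rfl
        · simp_all [run, Expr.eval, hj.ne]
        · simp_all [run, Expr.eval]
  exact hloop.2 i (by rwa [← hsize₁] at hi)

theorem fill_run_var {i e : Expr} {x : ℕ} (hx : x ≠ indexVar) :
    ((fill a i e).run σ).var x = σ.var x :=
  run_var_eq (by simpa [fill, writtenVars] using hx) σ

theorem fill_run {i e : Expr} {b : ℕ} {f : ℕ → ℕ} (hsize : σ.var sizeVar = n)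
    (h : ∀ j < n, ∀ τ, τ.var indexVar = j → (fill a i e).Frame σ τ →
      i.eval τ = b + j ∧ e.eval τ = f j) :
    (∀ j < n, ((fill a i e).run σ).arr a (b + j) = f j) ∧
      ∀ k < b, ((fill a i e).run σ).arr a k = σ.arr a k := by
  have hloop := loop_invariant (x := indexVar) (P := .store a i e) (σ := σ) List.not_mem_nil
    (fun i τ => (∀ j < i, τ.arr a (b + j) = f j) ∧ ∀ k < b, τ.arr a k = σ.arr a k)
    (by simp) fun j τ hj hτ hframe ⟨hnew, hold⟩ => by
      obtain ⟨hi, he⟩ := h j (hsize ▸ hj) τ hτ hframe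
      simp only [run, Memory.setVar_arr, Memory.setArr_arr_self, hi, he]
      refine ⟨fun k hk => ?_, fun k hk => ?_⟩
      · rcases Nat.lt_succ_iff_lt_or_eq.1 hk with hk | rfl
        · rw [Function.update_of_ne (by omega), hnew k hk]
        · exact Function.update_self _ _ _
      · rw [Function.update_of_ne (by omega), hold k hk]
  simp only [sizeVar] at hsize
  rwa [hsize] at hloop

theorem moveToken_run {x y : ℕ} (hx : σ.var x = v) (hy : σ.var y = u) :
    indicatedSet n (((moveToken a x y).run σ).arr a) =
      insert u ((indicatedSet n (σ.arr a)).erase v) := by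
  simp [moveToken, run, Expr.eval, hx, hy, indicatedSet_update_one, indicatedSet_update_zero]

/-! ### Computing components -/

@[simp] theorem writtenVars_markNeighbors :
    (markNeighbors a m).writtenVars = [rowVar, colVar] := rfl

@[simp] theorem writtenArrs_markNeighbors : (markNeighbors a m).writtenArrs = [m] := rfl

open Classical in
theorem markNeighbor_run (h : StoresGraph G s t σ) (hu : σ.var rowVar = u)
    (hv : σ.var colVar = v) :
    indicatedSet n (((markNeighbor a m).run σ).arr m) =
      if u ∈ indicatedSet n (σ.arr m) ∧ G.Adj u v ∧ v ∉ indicatedSet n (σ.arr a) then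
        insert v (indicatedSet n (σ.arr m)) else indicatedSet n (σ.arr m) := by
  rw [markNeighbor, run_whenAll]
  simp only [List.forall_mem_cons, List.not_mem_nil, false_imp_iff, implies_true, and_true,
    h.eval_adjExpr_ne_zero hu hv, eval_negExpr_ne_zero, mem_indicatedSet, not_not]
  simp only [Expr.eval, hu, hv]
  split_ifs
  · simp [run, Expr.eval, hv, indicatedSet_update_one]
  · rfl

theorem markNeighbors_run (h : StoresGraph G s t σ) (ham : a ≠ m) (hadj : adjArr ≠ m)
    (hrow : rowArr ≠ m) {C : Set (Fin n)} (hmC : ↑(indicatedSet n (σ.arr m)) ⊆ C)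
    (hC : boundary G C ⊆ indicatedSet n (σ.arr a)) :
    indicatedSet n (σ.arr m) ⊆ indicatedSet n (((markNeighbors a m).run σ).arr m) ∧
      (∀ u ∈ indicatedSet n (σ.arr m), ∀ v, G.Adj u v → v ∉ indicatedSet n (σ.arr a) →
        v ∈ indicatedSet n (((markNeighbors a m).run σ).arr m)) ∧
      ↑(indicatedSet n (((markNeighbors a m).run σ).arr m)) ⊆ C := by
  have hloop := loop_loop_invariant (x := rowVar) (y := colVar) (P := markNeighbor a m) (σ := σ)
    (by decide) List.not_mem_nil List.not_mem_nil (by simp [writtenVars, markNeighbor])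
    (fun D τ => indicatedSet n (σ.arr m) ⊆ indicatedSet n (τ.arr m) ∧
      (∀ u ∈ indicatedSet n (σ.arr m), ∀ v : Fin n, ((u : ℕ), (v : ℕ)) ∈ D → G.Adj u v →
        v ∉ indicatedSet n (σ.arr a) → v ∈ indicatedSet n (τ.arr m)) ∧
      ↑(indicatedSet n (τ.arr m)) ⊆ C)
    ⟨subset_rfl, by simp, hmC⟩ (fun _ _ _ _ _ => id) ?_
  · obtain ⟨hsub, hnbr, hτC⟩ := hloop
    exact ⟨hsub, fun u hu v =>
      hnbr u hu v ⟨u.2.trans_eq h.size.symm, v.2.trans_eq h.size.symm⟩, hτC⟩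
  rintro D i j τ hi hj hτi hτj hframe ⟨hsub, hnbr, hτC⟩
  obtain ⟨u, rfl⟩ : ∃ u : Fin n, (u : ℕ) = i := ⟨⟨i, h.size ▸ hi⟩, rfl⟩
  obtain ⟨v, rfl⟩ : ∃ v : Fin n, (v : ℕ) = j := ⟨⟨j, h.size ▸ hj⟩, rfl⟩
  have hτ : StoresGraph G s t τ := h.frame hframe (by simp [writtenVars, markNeighbor])
    (by simpa [writtenArrs, markNeighbor] using ⟨hadj, hrow⟩)
  have hτa : τ.arr a = σ.arr a := hframe.arr a (by simpa [writtenArrs, markNeighbor] using ham)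
  rw [markNeighbor_run hτ hτi hτj, hτa]
  split_ifs with hc
  · obtain ⟨hu, huv, hv⟩ := hc
    refine ⟨hsub.trans (Finset.subset_insert _ _), fun u' hu' v' hD huv' hv' => ?_, ?_⟩
    · rcases hD with hD | hD
      · simp [Fin.ext (congrArg Prod.snd hD)]
      · exact Finset.mem_insert_of_mem (hnbr u' hu' v' hD huv' hv')
    · rw [Finset.coe_insert]
      exact Set.insert_subset (by_contra fun hvC => hv (hC ⟨hvC, u, hτC hu, huv⟩)) hτC
  · refine ⟨hsub, fun u' hu' v' hD huv' hv' => ?_, hτC⟩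
    rcases hD with hD | hD
    · obtain rfl := Fin.ext (congrArg Prod.fst hD)
      obtain rfl := Fin.ext (congrArg Prod.snd hD)
      exact absurd ⟨hsub hu', huv', hv'⟩ hc
    · exact hnbr u' hu' v' hD huv' hv'

theorem markNeighbors_loop_run (h : StoresGraph G s t σ) (ham : a ≠ m) (hadj : adjArr ≠ m)
    (hrow : rowArr ≠ m)
    (hm : ∀ v, v ∈ indicatedSet n (σ.arr m) ↔ v = s ∧ s ∉ indicatedSet n (σ.arr a)) :
    indicatedSet n (((loop roundVar (markNeighbors a m)).run σ).arr m) =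
      component G (indicatedSet n (σ.arr a)) s := by
  set S := indicatedSet n (σ.arr a) with hS
  -- Every round marks a further vertex, until the marked set is closed.
  have hloop := loop_invariant (x := roundVar) (P := markNeighbors a m) (σ := σ) (by simp)
    (fun i τ => ↑(indicatedSet n (τ.arr m)) ⊆ component G S s ∧
      (s ∉ S → s ∈ indicatedSet n (τ.arr m)) ∧
      (i < (indicatedSet n (τ.arr m)).card ∨ boundary G (indicatedSet n (τ.arr m)) ⊆ S)) ?_ ?_
  · obtain ⟨hsub, hs, hlt | hclosed⟩ := hloop
    · have hle := Finset.card_le_univ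
        (indicatedSet n (((loop roundVar (markNeighbors a m)).run σ).arr m))
      rw [Fintype.card_fin] at hle
      exact absurd hlt (not_lt.2 (hle.trans_eq h.size.symm))
    · exact hsub.antisymm (component_subset hs hclosed)
  · refine ⟨fun v hv => ?_, fun hs => (hm s).2 ⟨rfl, hs⟩, ?_⟩
    · obtain ⟨rfl, hs⟩ := (hm v).1 hv
      exact self_mem_component hs
    · by_cases hs : s ∈ S
      · exact .inr fun v ⟨_, x, hx, _⟩ => absurd hs ((hm x).1 hx).2
      · exact .inl (Finset.card_pos.2 ⟨s, (hm s).2 ⟨rfl, hs⟩⟩)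
  rintro i τ - - hframe ⟨hsub, hs, hcount⟩
  have hτ : StoresGraph G s t τ := h.frame hframe (by simp [writtenVars])
    (by simpa [writtenArrs] using ⟨hadj, hrow⟩)
  have hτa : indicatedSet n (τ.arr a) = S := by
    rw [hS, hframe.arr a (by simpa [writtenArrs] using ham)]
  have hround := @markNeighbors_run _ _ _ _ _ _ _ hτ ham hadj hrow
  rw [hτa] at hround
  obtain ⟨hgrow, hnbr, hsub'⟩ := hround hsub boundary_component_subset
  refine ⟨hsub', fun h => hgrow (hs h), ?_⟩
  by_cases hclosed : boundary G (indicatedSet n (τ.arr m)) ⊆ S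
  · right
    rw [Memory.setVar_arr, (Finset.coe_subset.1 (hround subset_rfl hclosed).2.2).antisymm hgrow]
    exact hclosed
  · obtain ⟨v, ⟨hv, u, hu, huv⟩, hvS⟩ := Set.not_subset.1 hclosed
    have hlt := Finset.card_lt_card (hgrow.ssubset_of_mem_notMem (hnbr u hu v huv hvS) hv)
    exact .inl ((Nat.succ_le_of_lt (hcount.resolve_right hclosed)).trans_lt hlt)

theorem markComponent_run (h : StoresGraph G s t σ) (ham : a ≠ m) (hadj : adjArr ≠ m)
    (hrow : rowArr ≠ m) : indicatedSet n (((markComponent a m).run σ).arr m) =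
      component G (indicatedSet n (σ.arr a)) s := by
  rw [markComponent, run_seq, run_seq]
  have hclear := (fill_run (a := m) (i := .var indexVar) (e := .lit 0) (b := 0) (f := fun _ => 0)
    h.size fun j _ τ hτ _ => ⟨by simp [Expr.eval, hτ], rfl⟩).1
  have hframe₁ := frame_run (fill m (.var indexVar) (.lit 0)) σ
  set σ₁ := (fill m (.var indexVar) (.lit 0)).run σ
  set P := whenAll [negExpr (.get a (.var sourceVar))] (.store m (.var sourceVar) (.lit 1)) with hP
  have hframe₂ := frame_run P σ₁
  have h₁ : StoresGraph G s t σ₁ := h.frame hframe₁ (by simp [fill, writtenVars])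
    (by simpa [fill, writtenArrs] using ⟨hadj, hrow⟩)
  have h₂ : StoresGraph G s t (P.run σ₁) := h₁.frame hframe₂ (by simp [hP, writtenVars])
    (by simpa [hP, writtenArrs] using ⟨hadj, hrow⟩)
  have ha₁ : σ₁.arr a = σ.arr a := hframe₁.arr a (by simpa [fill, writtenArrs] using ham)
  have ha₂ : (P.run σ₁).arr a = σ.arr a :=
    (hframe₂.arr a (by simpa [hP, writtenArrs] using ham)).trans ha₁
  rw [markNeighbors_loop_run h₂ ham hadj hrow, ha₂]
  intro v
  rw [ha₂]
  simp only [mem_indicatedSet, hP, run_whenAll, List.forall_mem_singleton,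
    eval_negExpr_ne_zero, not_not]
  have hsource : σ₁.var 1 = s := h₁.source
  have hv : σ₁.arr m v = 0 := by simpa using hclear v v.2
  simp only [Expr.eval, sourceVar, hsource, ha₁]
  split_ifs with hs
  · by_cases hvs : v = s <;> simp [run, Expr.eval, hsource, hs, hvs, Fin.val_inj, hv]
  · simp [hs, hv]

end Routines

section Search

variable {n : ℕ} {G : SimpleGraph (Fin n)} {s t u v : Fin n} {S B : Finset (Fin n)}
  {L : List (Finset (Fin n))} {D : Set (ℕ × ℕ)} {σ τ : Memory}

/-! ### Searching for a slide -/

theorem prepareTrial_run_trialArr (h : StoresGraph G s t σ) (hv : σ.var fromVar = v)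
    (hu : σ.var toVar = u) : indicatedSet n ((prepareTrial.run σ).arr trialArr) =
      insert u ((indicatedSet n (σ.arr currentArr)).erase v) := by
  rw [prepareTrial, run_seq, run_seq, run_arr_eq (by decide)]
  have hcopy := (fill_run (a := trialArr) (i := .var indexVar)
    (e := .get currentArr (.var indexVar)) (b := 0) (f := σ.arr currentArr) h.size
    fun j _ τ hτ hframe => ⟨by simp [Expr.eval, hτ], by
      rw [Expr.eval, Expr.eval, hτ, hframe.arr currentArr (by decide)]⟩).1
  rw [moveToken_run ((run_var_eq (by decide) σ).trans hv) ((run_var_eq (by decide) σ).trans hu)]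
  exact congrArg (fun T => insert u (T.erase v))
    (indicatedSet_congr fun i hi => by simpa using hcopy i hi)

theorem prepareTrial_run_trialSideArr (h : StoresGraph G s t σ) :
    indicatedSet n ((prepareTrial.run σ).arr trialSideArr) =
      component G (indicatedSet n ((prepareTrial.run σ).arr trialArr)) s := by
  have hcopy := h.frame (frame_run (fill trialArr (.var indexVar)
    (.get currentArr (.var indexVar))) σ) (by decide) (by decide)
  have hmove := hcopy.frame (frame_run (moveToken trialArr fromVar toVar) _) (by decide)
    (by decide)
  rw [prepareTrial, run_seq, run_seq, markComponent_run hmove (by decide) (by decide) (by decide),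
    run_arr_eq (P := markComponent trialArr trialSideArr) (by decide)]

theorem progressConditions_iff (h : StoresState G s t B S L σ)
    (hside : indicatedSet n (σ.arr currentSideArr) = component G S s) (hv : σ.var fromVar = v)
    (hu : σ.var toVar = u)
    (htrial : indicatedSet n (σ.arr trialArr) = insert u (S.erase v))
    (htrialSide : indicatedSet n (σ.arr trialSideArr) = component G (insert u (S.erase v)) s) :
    (∀ e ∈ progressConditions, e.eval σ ≠ 0) ↔ IsProgress G s t B S v u := by
  have hS (w : Fin n) : σ.arr currentArr w ≠ 0 ↔ w ∈ S := by rw [← h.current, mem_indicatedSet]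
  have hB (w : Fin n) : σ.arr goalArr w ≠ 0 ↔ w ∈ B := by rw [← h.goal, mem_indicatedSet]
  have hT (w : Fin n) : σ.arr trialArr w ≠ 0 ↔ w ∈ insert u (S.erase v) := by
    rw [← htrial, mem_indicatedSet]
  have hBs (w : Fin n) : σ.arr goalSideArr w ≠ 0 ↔ w ∈ component G B s := by
    rw [← h.goalSide, Finset.mem_coe, mem_indicatedSet]
  have hSs (w : Fin n) : σ.arr currentSideArr w ≠ 0 ↔ w ∈ component G S s := by
    rw [← hside, Finset.mem_coe, mem_indicatedSet]
  have hTs (w : Fin n) : σ.arr trialSideArr w ≠ 0 ↔ w ∈ component G (insert u (S.erase v)) s := by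
    rw [← htrialSide, Finset.mem_coe, mem_indicatedSet]
  have hsides : (Expr.eq (negExpr (.get goalSideArr (.var fromVar)))
      (.lt (.lit 0) (.get currentSideArr (.var toVar)))).eval σ ≠ 0 ↔
      (v ∈ component G B s ↔ u ∉ component G S s) := by
    simp only [Expr.eval, negExpr, hv, hu, ← hBs, ← hSs, Nat.pos_iff_ne_zero]
    split_ifs <;> simp_all
  simp only [progressConditions, List.forall_mem_cons, List.not_mem_nil, false_imp_iff,
    implies_true, and_true, eval_negExpr_ne_zero, h.eval_adjExpr_ne_zero hv hu, hsides,
    ← not_ne_iff (b := 0)]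
  simp only [Expr.eval, hv, hu, h.source, h.sink, hS, hB, hT, hTs]
  exact ⟨fun ⟨h₁, h₂, h₃, h₄, h₅, h₆⟩ => ⟨h₁, h₂, h₃, h₄, h₅, isSeparator_iff.2 h₆⟩,
    fun h => ⟨h.1, h.2, h.3, h.4, h.5, isSeparator_iff.1 h.6⟩⟩

/-- The memory holds the result of a search for a progressing slide among the pairs in `D`: if the
found variable is non-zero, the next two variables hold such a slide, and otherwise there is
none. -/
def StoresSearchResult (G : SimpleGraph (Fin n)) (s t : Fin n) (B S : Finset (Fin n))
    (D : Set (ℕ × ℕ)) (σ : Memory) : Prop :=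
  (σ.var foundVar ≠ 0 ∧
      ∃ v u : Fin n, σ.var foundFromVar = v ∧ σ.var foundToVar = u ∧ IsProgress G s t B S v u) ∨
    (σ.var foundVar = 0 ∧
      ∀ v u : Fin n, ((v : ℕ), (u : ℕ)) ∈ D → ¬ IsProgress G s t B S v u)

theorem StoresSearchResult.frame {P : ForProgram} (h : StoresSearchResult G s t B S D σ)
    (hP : P.Frame σ τ)
    (hvar : ∀ x ∈ [foundVar, foundFromVar, foundToVar], x ∉ P.writtenVars) :
    StoresSearchResult G s t B S D τ := by
  rwa [StoresSearchResult, hP.var _ (hvar _ (by simp)), hP.var foundFromVar (hvar _ (by simp)),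
    hP.var foundToVar (hvar _ (by simp))]

theorem StoresSearchResult.run_trySlide (hD : StoresSearchResult G s t B S D σ)
    (h : StoresState G s t B S L σ)
    (hside : indicatedSet n (σ.arr currentSideArr) = component G S s) (hv : σ.var fromVar = v)
    (hu : σ.var toVar = u) :
    StoresSearchResult G s t B S (insert ((v : ℕ), (u : ℕ)) D) (trySlide.run σ) := by
  rw [trySlide, run_seq]
  have hframe := frame_run prepareTrial σ
  have htrial := prepareTrial_run_trialArr h.toStoresGraph hv hu
  have htrialSide := prepareTrial_run_trialSideArr h.toStoresGraph
  rw [htrial, h.current] at htrialSide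
  rw [h.current] at htrial
  set σ₁ := prepareTrial.run σ
  have hv₁ : σ₁.var fromVar = v := (hframe.var _ (by decide)).trans hv
  have hu₁ : σ₁.var toVar = u := (hframe.var _ (by decide)).trans hu
  have hiff := progressConditions_iff (h.frame hframe (by decide) (by decide))
    (by rwa [hframe.arr _ (by decide)]) hv₁ hu₁ htrial htrialSide
  rw [run_whenAll]
  split_ifs with hp <;> rw [hiff] at hp
  · exact .inl ⟨by simp [run, Expr.eval, Memory.setVar_var],
      v, u, by simpa [run, Expr.eval, Memory.setVar_var] using hv₁,
      by simpa [run, Expr.eval, Memory.setVar_var] using hu₁, hp⟩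
  · rcases hD.frame hframe (by decide) with hfound | ⟨hzero, hnone⟩
    · exact .inl hfound
    · refine .inr ⟨hzero, fun v' u' hD => ?_⟩
      rcases hD with hD | hD
      · obtain rfl := Fin.ext (congrArg Prod.fst hD)
        obtain rfl := Fin.ext (congrArg Prod.snd hD)
        exact hp
      · exact hnone v' u' hD

theorem searchSlide_run (h : StoresState G s t B S L σ)
    (hside : indicatedSet n (σ.arr currentSideArr) = component G S s) :
    StoresSearchResult G s t B S Set.univ (searchSlide.run σ) := by
  rw [searchSlide, run_seq]
  have hframe₁ := frame_run (.assign foundVar (.lit 0)) σ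
  have hfound : (run (.assign foundVar (.lit 0)) σ).var foundVar = 0 := Memory.setVar_var_self _ _ _
  set σ₁ := run (.assign foundVar (.lit 0)) σ
  have h₁ : StoresState G s t B S L σ₁ := h.frame hframe₁ (by decide) (by decide)
  have hloop := loop_loop_invariant (x := fromVar) (y := toVar) (P := trySlide) (σ := σ₁)
    (by decide) (by decide) (by decide) (by decide) (StoresSearchResult G s t B S)
    (.inr ⟨hfound, by simp⟩) (fun D τ z k hz hJ => ?_) fun D i j τ hi hj hτi hτj hframe hJ => ?_
  · refine hloop.imp_right fun ⟨hzero, hnone⟩ => ⟨hzero, fun v u _ => hnone v u ?_⟩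
    exact ⟨v.2.trans_eq h₁.size.symm, u.2.trans_eq h₁.size.symm⟩
  · refine hJ.frame (frame_loop_setVar z .skip τ k) ?_
    rcases hz with rfl | rfl <;> decide
  · obtain ⟨v, rfl⟩ : ∃ v : Fin n, (v : ℕ) = i := ⟨⟨i, hi.trans_eq h₁.size⟩, rfl⟩
    obtain ⟨u, rfl⟩ : ∃ u : Fin n, (u : ℕ) = j := ⟨⟨j, hj.trans_eq h₁.size⟩, rfl⟩
    refine hJ.run_trySlide (h₁.frame hframe (by decide) (by decide)) ?_ hτi hτj
    rwa [hframe.arr currentSideArr (by decide), hframe₁.arr currentSideArr (by decide)]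

end Search

section Greedy

variable {n : ℕ} {G : SimpleGraph (Fin n)} {s t u v : Fin n} {A B S : Finset (Fin n)}
  {L : List (Finset (Fin n))} {σ τ : Memory}

/-! ### The greedy algorithm -/

theorem StoresState.run_appendOutput (h : StoresState G s t B S L σ) :
    StoresState G s t B S (L ++ [S]) (appendOutput.run σ) := by
  have hframe := frame_run appendOutput σ
  have hcount : (appendOutput.run σ).var countVar = σ.var countVar + 1 := by
    simp [appendOutput, run_seq, run, Expr.eval, Memory.setVar_var,
      fill_run_var]
  obtain ⟨hnew, hold⟩ := fill_run (a := outputArr)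
    (i := .add (.var outputEndVar) (.var indexVar))
    (e := .lt (.lit 0) (.get currentArr (.var indexVar))) (b := σ.var countVar * n)
    (f := fun j => if 0 < σ.arr currentArr j then 1 else 0) h.size fun j _ τ hτ hfill => by
      simp only [Expr.eval, hτ, hfill.var outputEndVar (by decide),
        hfill.arr currentArr (by decide), h.outputEnd, and_self]
  refine ⟨h.toStoresGraph.frame hframe (by decide) (by decide), ?_, ?_, ?_, ?_, ?_⟩
  · rw [hframe.arr _ (by decide), h.current]
  · rw [hframe.arr _ (by decide), h.goal]
  · rw [hframe.arr _ (by decide), h.goalSide]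
  · rw [← h.output]
    refine outputSequence_eq_concat hcount hold fun v => ?_
    rw [← h.current, mem_indicatedSet, ← Nat.pos_iff_ne_zero]
    exact (Eq.congr_left (hnew v v.2)).trans (by simp)
  · have hend : (appendOutput.run σ).var outputEndVar =
        σ.var outputEndVar + σ.var sizeVar := by
      simp [appendOutput, run_seq, run, Expr.eval, Memory.setVar_var,
        fill_run_var]
    rw [hend, hcount, h.outputEnd, h.size, Nat.succ_mul]

theorem StoresState.run_moveToken (h : StoresState G s t B S L σ) (hv : σ.var foundFromVar = v)
    (hu : σ.var foundToVar = u) :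
    StoresState G s t B (insert u (S.erase v)) L
      ((moveToken currentArr foundFromVar foundToVar).run σ) := by
  have hframe := frame_run (moveToken currentArr foundFromVar foundToVar) σ
  refine ⟨h.toStoresGraph.frame hframe (by decide) (by decide), ?_, ?_, ?_, ?_, ?_⟩
  · rw [moveToken_run hv hu, h.current]
  · rw [hframe.arr _ (by decide), h.goal]
  · rw [hframe.arr _ (by decide), h.goalSide]
  · rw [outputSequence_congr (hframe.var _ (by decide)) (hframe.arr _ (by decide)), h.output]
  · rw [hframe.var _ (by decide), hframe.var countVar (by decide), h.outputEnd]

theorem slideOnce_run (h : StoresState G s t B S L σ) :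
    (StoresState G s t B S L (slideOnce.run σ) ∧ ∀ v u, ¬ IsProgress G s t B S v u) ∨
      ∃ v u, IsProgress G s t B S v u ∧ StoresState G s t B (insert u (S.erase v))
        (L ++ [insert u (S.erase v)]) (slideOnce.run σ) := by
  rw [slideOnce, run_seq, run_seq]
  have hside := markComponent_run (a := currentArr) (m := currentSideArr) h.toStoresGraph
    (by decide) (by decide) (by decide)
  rw [h.current] at hside
  have hmark := h.frame (frame_run (markComponent currentArr currentSideArr) σ) (by decide)
    (by decide)
  set σ₁ := (markComponent currentArr currentSideArr).run σ
  have hsearch := hmark.frame (frame_run searchSlide σ₁) (by decide) (by decide)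
  rw [run_whenAll]
  rcases searchSlide_run hmark hside with ⟨hfound, v, u, hv, hu, hp⟩ | ⟨hzero, hnone⟩
  · rw [if_pos (by simpa [Expr.eval] using hfound), run_seq]
    exact .inr ⟨v, u, hp, (hsearch.run_moveToken hv hu).run_appendOutput⟩
  · rw [if_neg (by simpa [Expr.eval] using hzero)]
    exact .inl ⟨hsearch, fun v u => hnone v u (Set.mem_univ _)⟩

theorem loop_slideOnce_run (h : StoresState G s t B A [A] σ) (hA : IsMinSeparator G s t A) :
    ∃ S L, StoresState G s t B S L ((loop stepVar slideOnce).run σ) ∧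
      IsGreedySequence G s t A B L S ∧ ∀ v u, ¬ IsProgress G s t B S v u := by
  have hloop := loop_invariant (x := stepVar) (P := slideOnce) (σ := σ) (by decide)
    (fun i τ => ∃ S L, StoresState G s t B S L τ ∧ IsGreedySequence G s t A B L S ∧
      (L.length = i + 1 ∨ ∀ v u, ¬ IsProgress G s t B S v u))
    ⟨A, [A], h.setVar (by decide) 0, .singleton, .inl rfl⟩ ?_
  · obtain ⟨S, L, hS, hL, hlen | hstuck⟩ := hloop
    · refine ⟨S, L, hS, hL, fun v u hp => ?_⟩
      have hle := (hL.concat hp).length_le_card_add_one hA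
      rw [List.length_append, hlen, Fintype.card_fin, List.length_singleton] at hle
      have hsize : σ.var 0 = n := h.size
      omega
    · exact ⟨S, L, hS, hL, hstuck⟩
  rintro i τ - - - ⟨S, L, hS, hL, hlen⟩
  rcases slideOnce_run hS with ⟨hS', hstuck⟩ | ⟨v, u, hp, hS'⟩
  · exact ⟨S, L, hS'.setVar (by decide) _, hL, .inr hstuck⟩
  · refine ⟨_, _, hS'.setVar (by decide) _, hL.concat hp, hlen.imp (fun hlen => ?_) ?_⟩
    · rw [List.length_append, hlen, List.length_singleton]
    · exact fun hstuck => absurd hp (hstuck v u)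

theorem decideDone_run (hsize : σ.var sizeVar = n) : (decideDone.run σ).var answerVar =
    if indicatedSet n (σ.arr currentArr) ⊆ indicatedSet n (σ.arr goalArr) then 1 else 0 := by
  rw [decideDone, run_seq]
  have hanswer : (run (.assign answerVar (.lit 1)) σ).var answerVar = 1 :=
    Memory.setVar_var_self _ _ _
  have hframe₁ := frame_run (.assign answerVar (.lit 1)) σ
  set σ₁ := run (.assign answerVar (.lit 1)) σ
  have hloop := loop_invariant (x := indexVar) (σ := σ₁)
    (P := whenAll [.get currentArr (.var indexVar), negExpr (.get goalArr (.var indexVar))]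
      (.assign answerVar (.lit 0))) (by decide)
    (fun i τ => τ.var answerVar =
      if ∀ j < i, σ.arr currentArr j ≠ 0 → σ.arr goalArr j ≠ 0 then 1 else 0)
    (by simpa [Memory.setVar_var] using hanswer) fun i τ _ hi hframe hI => by
      have hcurrent : τ.arr currentArr = σ.arr currentArr := hframe.arr _ (by decide)
      have hgoal : τ.arr goalArr = σ.arr goalArr := hframe.arr _ (by decide)
      rw [Memory.setVar_var_of_ne _ (by decide), run_whenAll]
      simp only [List.forall_mem_cons, List.not_mem_nil, false_imp_iff, implies_true, and_true,
        eval_negExpr_ne_zero]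
      simp only [Expr.eval, hi, hcurrent, hgoal, Nat.forall_lt_succ_right]
      split_ifs with hc hall hall
      · exact absurd hc.2 (hall.2 hc.1)
      · exact Memory.setVar_var_self _ _ _
      · rw [hI, if_pos hall.1]
      · rw [hI, if_neg fun h => hall ⟨h, fun hi hi' => hc ⟨hi, hi'⟩⟩]
  rw [hloop, hframe₁.var 0 (by decide)]
  refine if_congr ⟨fun h w => ?_, fun h j hj => ?_⟩ rfl rfl
  · simpa using h w (w.2.trans_eq hsize.symm)
  · simpa using @h ⟨j, hj.trans_eq hsize⟩

/-! ### Correctness -/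

theorem inputMemory_adj :
    (inputMemory G s t A B).arr adjArr (u * n + v) ≠ 0 ↔ G.Adj u v := by
  simp only [inputMemory, if_true, ite_ne_right_iff]
  refine ⟨?_, fun h => ⟨⟨u, v, rfl, h⟩, one_ne_zero⟩⟩
  rintro ⟨⟨u', v', heq, hadj⟩, -⟩
  have hmod := congrArg (· % n) heq
  simp only [Nat.mul_add_mod', Nat.mod_eq_of_lt v.2, Nat.mod_eq_of_lt v'.2] at hmod
  rw [hmod, Nat.add_right_cancel_iff] at heq
  rwa [Fin.ext (Nat.eq_of_mul_eq_mul_right u.pos heq), Fin.ext hmod]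

theorem storesGraph_buildRows_inputMemory :
    StoresGraph G s t (buildRows.run (inputMemory G s t A B)) where
  size := run_var_eq (by decide) _
  source := run_var_eq (by decide) _
  sink := run_var_eq (by decide) _
  adj _ _ := by rw [run_arr_eq (by decide), inputMemory_adj]
  rows _ hi := buildRows_run rfl hi

theorem storesState_markComponent_inputMemory : StoresState G s t B A []
    ((markComponent goalArr goalSideArr).run (buildRows.run (inputMemory G s t A B))) := by
  have hgraph : StoresGraph G s t (buildRows.run (inputMemory G s t A B)) :=
    storesGraph_buildRows_inputMemory
  have hframe₁ := frame_run buildRows (inputMemory G s t A B)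
  have hframe₂ := frame_run (markComponent goalArr goalSideArr)
    (buildRows.run (inputMemory G s t A B))
  have hgoal : indicatedSet n ((buildRows.run (inputMemory G s t A B)).arr goalArr) = B := by
    rw [hframe₁.arr _ (by decide)]
    ext w
    simp [inputMemory, Fin.val_inj]
  have hcount : ((markComponent goalArr goalSideArr).run
      (buildRows.run (inputMemory G s t A B))).var countVar = 0 := by
    rw [hframe₂.var _ (by decide), hframe₁.var _ (by decide)]
    rfl
  refine ⟨hgraph.frame hframe₂ (by decide) (by decide), ?_, ?_, ?_, ?_, ?_⟩
  · rw [hframe₂.arr _ (by decide), hframe₁.arr _ (by decide)]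
    ext w
    simp [inputMemory, Fin.val_inj]
  · rw [hframe₂.arr _ (by decide), hgoal]
  · rw [markComponent_run hgraph (by decide) (by decide) (by decide), hgoal]
  · exact List.length_eq_zero_iff.1 (by simpa [outputSequence] using hcount)
  · rw [hcount, Nat.zero_mul, hframe₂.var _ (by decide), hframe₁.var _ (by decide)]
    rfl

theorem slidingProgram_run (hA : IsMinSeparator G s t A) (hB : IsMinSeparator G s t B) :
    ((∃ L, IsSlideSequence G s t A B L) →
      OutputYes (slidingProgram.run (inputMemory G s t A B)) ∧
      IsShortestSlideSequence G s t A B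
        (outputSequence n (slidingProgram.run (inputMemory G s t A B)))) ∧
    ((¬ ∃ L, IsSlideSequence G s t A B L) →
      OutputNo (slidingProgram.run (inputMemory G s t A B))) := by
  rw [slidingProgram, run_seq, run_seq, run_seq, run_seq]
  obtain ⟨S, L, hS, hL, hstuck⟩ :=
    loop_slideOnce_run storesState_markComponent_inputMemory.run_appendOutput hA
  have hanswer := decideDone_run hS.size
  rw [hS.current, hS.goal] at hanswer
  rw [outputSequence_congr (run_var_eq (by decide) _) (run_arr_eq (by decide) _), hS.output,
    OutputYes, OutputNo, hanswer]
  refine ⟨fun hAB => ?_, fun hAB => if_neg fun hSB => ?_⟩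
  · obtain rfl := hL.eq_of_forall_not_isProgress hAB hstuck
    exact ⟨if_pos subset_rfl, hL.isShortestSlideSequence hA⟩
  · have hAS := hL.isSlideSequence hA
    have hcard := (hAS.isMinSeparator_right.card_eq hB).ge
    exact hAB ⟨L, Finset.eq_of_subset_of_card_le hSB hcard ▸ hAS⟩

end Greedy

end TokenSliding

theorem mainTheorem5 :
    ∃ (P : RAM.Program) (p : Polynomial ℕ),
      ∀ (n : ℕ) (G : SimpleGraph (Fin n)) (s t : Fin n) (A B : Finset (Fin n)),
        TokenSliding.IsMinSeparator G s t A → TokenSliding.IsMinSeparator G s t B →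
          ∃ (T : ℕ) (σ : RAM.Memory),
            RAM.Exec P (TokenSliding.inputMemory G s t A B) T σ ∧ T ≤ p.eval n ∧
            ((∃ L, TokenSliding.IsSlideSequence G s t A B L) →
              TokenSliding.OutputYes σ ∧
              TokenSliding.IsShortestSlideSequence G s t A B (TokenSliding.outputSequence n σ)) ∧
            ((¬ ∃ L, TokenSliding.IsSlideSequence G s t A B L) → TokenSliding.OutputNo σ) := by
  obtain ⟨p, hp⟩ := TokenSliding.slidingProgram_wellFormed.exists_exec
  refine ⟨TokenSliding.slidingProgram.compile, p, fun n G s t A B hA hB => ?_⟩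
  obtain ⟨T, hT, hexec⟩ := hp (TokenSliding.inputMemory G s t A B)
  exact ⟨T, _, hexec, hT, TokenSliding.slidingProgram_run hA hB⟩
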